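/- An automaton over a finite alphabet $A$ consists of a finite set of states $Q$ and a finite set of edges, each edge having a source, a target and a label in $A$. It is deterministic if for every state $p$ and letter $a$ at most one edge starts in $p$ and has label $a$. For an automaton $\mathcal A$, let $X_{\mathcal A}$ be the shift space of biinfinite paths (sequences of consecutive edges), $L_{\mathcal A}$ the shift space of labels of biinfinite paths, and $\lambda_{\mathcal A}:X_{\mathcal A}\to L_{\mathcal A}$ the labelling map. A conjugacy of shift spaces is a continuous bijection commuting with the shift. Automata $\mathcal A,\mathcal B$ (possibly over different alphabets) are symbolic conjugate if there are conjugacies $\varphi:X_{\mathcal A}\to X_{\mathcal B}$ and $\psi:L_{\mathcal A}\to L_{\mathcal B}$ with $\psi\circ\lambda_{\mathcal A}=\lambda_{\mathcal B}\circ\varphi$. The transition semigroup $S(\mathcal A)$ of a deterministic automaton $\mathcal A$ is the semigroup of all partial maps $p\mapsto p\cdot w$ of $Q$ into itself, for nonempty words $w$. The syntactic graph $G(\mathcal A)$ has as vertices the regular $\mathcal D$-classes of $S(\mathcal A)$ (those containing an idempotent), each labelled by its rank (the number of elements of the image of any of its elements) and by its structure group (the $\mathcal H$-class of any of its idempotents,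 up to isomorphism); there is an edge from $D$ to $D'$ if and only if $D\ge_{\mathcal J}D'$. There is at most one vertex of rank $0$, namely the class of the empty partial map when the latter is in $S(\mathcal A)$. An isomorphism of syntactic graphs is a bijection of the vertices which preserves and reflects edges and preserves ranks and structure groups (up to isomorphism). **Theorem.** Let $\mathcal A$ and $\mathcal B$ be symbolic conjugate deterministic automata. Then the graphs obtained from $G(\mathcal A)$ and $G(\mathcal B)$ by removing the vertex of rank $0$, if there is one, are isomorphic. Moreover $G(\mathcal A)$ and $G(\mathcal B)$ themselves are isomorphic if and only if the empty partial map belongs either to both of $S(\mathcal A)$ and $S(\mathcal B)$ or to neither of them. -/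

import Mathlib

open SymbolicDynamics.FullShift

namespace SymbolicAutomata

/-! ### Green's relations in a semigroup

`WithOne S` is `S¹ = S ∪ {1}`, the semigroup `S` with an identity added. -/

section Green

variable {S : Type*} [Semigroup S]

/-- `s 𝓡 t` if and only if `s S¹ = t S¹`. -/
def GreenR (s t : S) : Prop :=
  Set.range (fun x : WithOne S => (s : WithOne S) * x) =
    Set.range (fun x : WithOne S => (t : WithOne S) * x)

/-- `s 𝓛 t` if and only if `S¹ s = S¹ t`. -/
def GreenL (s t : S) : Prop :=
  Set.range (fun x : WithOne S => x * (s : WithOne S)) =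
    Set.range (fun x : WithOne S => x * (t : WithOne S))

/-- `𝓗 = 𝓡 ∩ 𝓛`. -/
def GreenH (s t : S) : Prop := GreenR s t ∧ GreenL s t

/-- `𝓓 = 𝓛𝓡`. -/
def GreenD (s t : S) : Prop := ∃ u, GreenL s u ∧ GreenR u t

/-- `s ≤_𝓙 t` if and only if `S¹ s S¹ ⊆ S¹ t S¹`. -/
def JLE (s t : S) : Prop :=
  Set.range (fun x : WithOne S × WithOne S => x.1 * (s : WithOne S) * x.2) ⊆
    Set.range (fun x : WithOne S × WithOne S => x.1 * (t : WithOne S) * x.2)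

/-- `C` is a `𝓓`-class which contains an idempotent. -/
def IsRegularDClass (C : Set S) : Prop :=
  (∃ s, C = {t | GreenD s t}) ∧ ∃ e ∈ C, IsIdempotentElem e

/-- The order induced by `≤_𝓙` on `𝓓`-classes: `C ≤_𝓙 D`. -/
def DClassLE (C D : Set S) : Prop := ∃ s ∈ C, ∃ t ∈ D, JLE s t

theorem greenR_iff (s t : S) : GreenR s t ↔
    (∃ x : WithOne S, (t : WithOne S) * x = s) ∧ ∃ y : WithOne S, (s : WithOne S) * y = t := by
  constructor
  · intro h
    refine ⟨?_, ?_⟩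
    · have : (s : WithOne S) ∈ Set.range (fun x : WithOne S => (s : WithOne S) * x) :=
        ⟨1, mul_one _⟩
      rw [h] at this
      exact this
    · have : (t : WithOne S) ∈ Set.range (fun x : WithOne S => (t : WithOne S) * x) :=
        ⟨1, mul_one _⟩
      rw [← h] at this
      exact this
  · rintro ⟨⟨x, hx⟩, y, hy⟩
    apply Set.Subset.antisymm
    · rintro _ ⟨z, rfl⟩
      exact ⟨x * z, by simp only [← mul_assoc, hx]⟩
    · rintro _ ⟨z, rfl⟩
      exact ⟨y * z, by simp only [← mul_assoc, hy]⟩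

theorem greenL_iff (s t : S) : GreenL s t ↔
    (∃ x : WithOne S, x * (t : WithOne S) = s) ∧ ∃ y : WithOne S, y * (s : WithOne S) = t := by
  constructor
  · intro h
    refine ⟨?_, ?_⟩
    · have : (s : WithOne S) ∈ Set.range (fun x : WithOne S => x * (s : WithOne S)) :=
        ⟨1, one_mul _⟩
      rw [h] at this
      exact this
    · have : (t : WithOne S) ∈ Set.range (fun x : WithOne S => x * (t : WithOne S)) :=
        ⟨1, one_mul _⟩
      rw [← h] at this
      exact this
  · rintro ⟨⟨x, hx⟩, y, hy⟩
    apply Set.Subset.antisymm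
    · rintro _ ⟨z, rfl⟩
      exact ⟨z * x, by simp only [mul_assoc, hx]⟩
    · rintro _ ⟨z, rfl⟩
      exact ⟨z * y, by simp only [mul_assoc, hy]⟩

theorem GreenH.idem_mul {s e : S} (he : IsIdempotentElem e) (h : GreenH s e) : e * s = s := by
  obtain ⟨⟨x, hx⟩, -⟩ := (greenR_iff s e).1 h.1
  have he' : (e : WithOne S) * e = e := by exact_mod_cast congrArg WithOne.coe he
  have : (e : WithOne S) * s = s := by rw [← hx, ← mul_assoc, he']
  exact_mod_cast this

theorem GreenH.mul_idem {s e : S} (he : IsIdempotentElem e) (h : GreenH s e) : s * e = s := by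
  obtain ⟨⟨x, hx⟩, -⟩ := (greenL_iff s e).1 h.2
  have he' : (e : WithOne S) * e = e := by exact_mod_cast congrArg WithOne.coe he
  have : (s : WithOne S) * e = s := by rw [← hx, mul_assoc, he']
  exact_mod_cast this

/-- The `𝓗`-class of an idempotent `e` consists of the units of `e S e`. -/
theorem greenH_idem_iff {s e : S} (he : IsIdempotentElem e) :
    GreenH s e ↔ e * s = s ∧ s * e = s ∧ ∃ t, e * t = t ∧ t * e = t ∧ t * s = e ∧ s * t = e := by
  have he' : (e : WithOne S) * e = e := by exact_mod_cast congrArg WithOne.coe he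
  constructor
  · intro h
    have h1 := h.idem_mul he
    have h2 := h.mul_idem he
    refine ⟨h1, h2, ?_⟩
    obtain ⟨-, y, hy⟩ := (greenR_iff s e).1 h.1
    obtain ⟨-, z, hz⟩ := (greenL_iff s e).1 h.2
    have hez : (e : WithOne S) * y = z * e := by
      rw [← hz, mul_assoc, hy, hz]
    obtain ⟨t, ht⟩ : ∃ t : S, (t : WithOne S) = e * y := by
      refine WithOne.cases_on y ?_ ?_
      · exact ⟨e, by simp⟩
      · exact fun a => ⟨e * a, by simp⟩
    refine ⟨t, ?_, ?_, ?_, ?_⟩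
    · have : (e : WithOne S) * t = t := by rw [ht, ← mul_assoc, he']
      exact_mod_cast this
    · have : (t : WithOne S) * e = t := by rw [ht, hez, mul_assoc, he']
      exact_mod_cast this
    · have h1' : (e : WithOne S) * s = s := by exact_mod_cast congrArg WithOne.coe h1
      have : (t : WithOne S) * s = e := by rw [ht, hez, mul_assoc, h1', hz]
      exact_mod_cast this
    · have h2' : (s : WithOne S) * e = s := by exact_mod_cast congrArg WithOne.coe h2
      have : (s : WithOne S) * t = e := by rw [ht, ← mul_assoc, h2', hy]
      exact_mod_cast this
  · rintro ⟨h1, h2, t, -, -, h3, h4⟩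
    refine ⟨(greenR_iff s e).2 ⟨⟨s, ?_⟩, t, ?_⟩, (greenL_iff s e).2 ⟨⟨s, ?_⟩, t, ?_⟩⟩
    · exact_mod_cast congrArg WithOne.coe h1
    · exact_mod_cast congrArg WithOne.coe h4
    · exact_mod_cast congrArg WithOne.coe h2
    · exact_mod_cast congrArg WithOne.coe h3

/-- The `𝓗`-class of an idempotent `e`. -/
def HClass (e : {e : S // IsIdempotentElem e}) : Type _ := {s : S // GreenH s e.1}

/-- The `𝓗`-class of an idempotent is a group for the multiplication of `S`. -/
noncomputable instance (e : {e : S // IsIdempotentElem e}) : Group (HClass e) :=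
  letI : Mul (HClass e) := ⟨fun s t => ⟨s.1 * t.1, by
    obtain ⟨a1, a2, a, a3, a4, a5, a6⟩ := (greenH_idem_iff e.2).1 s.2
    obtain ⟨b1, b2, b, b3, b4, b5, b6⟩ := (greenH_idem_iff e.2).1 t.2
    refine (greenH_idem_iff e.2).2
      ⟨by rw [← mul_assoc, a1], by rw [mul_assoc, b2], b * a, ?_, ?_, ?_, ?_⟩
    · rw [← mul_assoc, b3]
    · rw [mul_assoc, a4]
    · rw [mul_assoc, ← mul_assoc a, a5, b1, b5]
    · rw [mul_assoc, ← mul_assoc t.1, b6, a3, a6]⟩⟩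
  letI : One (HClass e) :=
    ⟨⟨e.1, (greenH_idem_iff e.2).2 ⟨e.2, e.2, e.1, e.2, e.2, e.2, e.2⟩⟩⟩
  letI : Inv (HClass e) := ⟨fun s =>
    ⟨((greenH_idem_iff e.2).1 s.2).2.2.choose, by
      have h := ((greenH_idem_iff e.2).1 s.2).2.2.choose_spec
      exact (greenH_idem_iff e.2).2 ⟨h.1, h.2.1, s.1, ((greenH_idem_iff e.2).1 s.2).1,
        ((greenH_idem_iff e.2).1 s.2).2.1, h.2.2.2, h.2.2.1⟩⟩⟩
  Group.ofLeftAxioms (fun a b c => Subtype.ext (mul_assoc a.1 b.1 c.1))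
    (fun a => Subtype.ext ((greenH_idem_iff e.2).1 a.2).1)
    (fun a => Subtype.ext ((greenH_idem_iff e.2).1 a.2).2.2.choose_spec.2.2.1)

end Green

/-! ### Conjugacy of shift spaces -/

/-- A map `φ : X → Y` between shift spaces is a conjugacy if it is continuous, bijective, and
commutes with the shift. -/
def IsConjugacy {A B : Type*} [TopologicalSpace A] [TopologicalSpace B]
    (X : Subshift A ℤ) (Y : Subshift B ℤ) (φ : X.carrier → Y.carrier) : Prop :=
  Continuous φ ∧ Function.Bijective φ ∧
    ∀ x, φ ((X.mapsTo 1).restrict _ _ _ x) = (Y.mapsTo 1).restrict _ _ _ (φ x)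

/-! ### Automata -/

/-- An automaton over the alphabet `A` with set of states `Q` and set of edges `E`, all of whose
states are initial and final. An edge `e` goes from `src e` to `tgt e` and has label `lab e`. -/
structure Automaton (A Q E : Type*) where
  src : E → Q
  tgt : E → Q
  lab : E → A

namespace Automaton

variable {A Q E : Type*} (M : Automaton A Q E)

/-- For each state `p` and each letter `a`, at most one edge starts in `p` with label `a`. -/
def IsDeterministic : Prop := ∀ e e', M.src e = M.src e' → M.lab e = M.lab e' → e = e'

section Shifts

variable [TopologicalSpace E] [DiscreteTopology E]

/-- The edge shift `X_M` of biinfinite paths of `M`. -/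
def pathShift : Subshift E ℤ where
  carrier := {x | ∀ n, M.tgt (x n) = M.src (x (n + 1))}
  isClosed := by
    let _ : TopologicalSpace Q := ⊥
    have : DiscreteTopology Q := ⟨rfl⟩
    simp only [Set.ofPred_forall]
    refine isClosed_iInter fun n => isClosed_eq ?_ ?_
    · exact continuous_of_discreteTopology.comp (continuous_apply n)
    · exact continuous_of_discreteTopology.comp (continuous_apply (n + 1))
  mapsTo := fun g x hx n => by
    simpa [shift, add_assoc] using hx (g + n)

variable [TopologicalSpace A] [DiscreteTopology A] [Finite E]

/-- The shift `L_M` of labels of biinfinite paths of `M`. -/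
def labelShift : Subshift A ℤ where
  carrier := (fun x n => M.lab (x n)) '' M.pathShift.carrier
  isClosed := by
    refine (M.pathShift.isClosed.isCompact.image ?_).isClosed
    exact continuous_pi fun n => continuous_of_discreteTopology.comp (continuous_apply n)
  mapsTo := by
    rintro g _ ⟨x, hx, rfl⟩
    exact ⟨shift g x, M.pathShift.mapsTo g hx, rfl⟩

/-- The map `λ_M : X_M → L_M` which assigns its label to a path. -/
def labelMap (x : M.pathShift.carrier) : M.labelShift.carrier :=
  ⟨fun n => M.lab (x.1 n), x.1, x.2, rfl⟩

/-- `M` and `N` are symbolic conjugate: there are conjugacies `φ : X_M → X_N` and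
`ψ : L_M → L_N` such that `ψ ∘ λ_M = λ_N ∘ φ`. -/
def SymbolicConjugate {B R F : Type*} [TopologicalSpace F] [DiscreteTopology F]
    [TopologicalSpace B] [DiscreteTopology B] [Finite F] (N : Automaton B R F) : Prop :=
  ∃ (φ : M.pathShift.carrier → N.pathShift.carrier)
    (ψ : M.labelShift.carrier → N.labelShift.carrier),
    IsConjugacy M.pathShift N.pathShift φ ∧ IsConjugacy M.labelShift N.labelShift ψ ∧
      ∀ x, ψ (M.labelMap x) = N.labelMap (φ x)

end Shifts

/-! ### The transition semigroup of a deterministic automaton -/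

/-- The partial map `p ↦ p · a` defined by a letter `a`: the end of the edge starting in `p` with
label `a`, if there is one. This edge is unique if `M` is deterministic; the definition is only
meaningful in that case. -/
noncomputable def step (a : A) : Q →. Q := fun p =>
  ⟨∃ e, M.src e = p ∧ M.lab e = a, fun h => M.tgt h.choose⟩

variable {M} in
theorem IsDeterministic.mem_step_iff (hM : M.IsDeterministic) (a : A) (p q : Q) :
    q ∈ M.step a p ↔ ∃ e, M.src e = p ∧ M.lab e = a ∧ M.tgt e = q := by
  constructor
  · rintro ⟨h, rfl⟩
    exact ⟨_, h.choose_spec.1, h.choose_spec.2, rfl⟩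
  · rintro ⟨e, h1, h2, rfl⟩
    refine ⟨⟨e, h1, h2⟩, ?_⟩
    have h : ∃ e, M.src e = p ∧ M.lab e = a := ⟨e, h1, h2⟩
    exact congrArg M.tgt
      (hM _ e (h.choose_spec.1.trans h1.symm) (h.choose_spec.2.trans h2.symm))

/-- The partial map `φ_M(w) : p ↦ p · w` defined by a word `w`. -/
noncomputable def act : List A → (Q →. Q)
  | [] => PFun.id Q
  | a :: w => (act w).comp (M.step a)

theorem act_append (u v : List A) : M.act (u ++ v) = (M.act v).comp (M.act u) := by
  induction u with
  | nil => simp [act, PFun.comp_id]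
  | cons a u ih => simp [act, ih, PFun.comp_assoc]

/-- The transition semigroup of `M`: the partial maps `φ_M(w)` for nonempty words `w`. -/
def TransitionSemigroup : Type _ := {s : Q →. Q // ∃ w : List A, w ≠ [] ∧ M.act w = s}

/-- The product `s * t` is `s` followed by `t`, so that `φ_M(uv) = φ_M(u) * φ_M(v)`. -/
instance : Semigroup M.TransitionSemigroup where
  mul s t := ⟨t.1.comp s.1, by
    obtain ⟨u, hu, hs⟩ := s.2
    obtain ⟨v, -, ht⟩ := t.2
    exact ⟨u ++ v, by simp [hu], by rw [act_append, hs, ht]⟩⟩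
  mul_assoc s t r := Subtype.ext (PFun.comp_assoc r.1 t.1 s.1).symm

variable {M} in
/-- The rank of a partial map: the number of elements of its image. -/
noncomputable def TransitionSemigroup.rank (s : M.TransitionSemigroup) : ℕ := s.1.ran.ncard

/-! ### The syntactic graph of a deterministic automaton -/

/-- The vertices of the syntactic graph: the regular `𝓓`-classes of the transition semigroup. -/
def Vertex : Type _ := {C : Set M.TransitionSemigroup // IsRegularDClass C}

variable {M} in
/-- There is an edge from `C` to `D` if and only if `C ≥_𝓙 D`. -/
def Vertex.Edge (C D : M.Vertex) : Prop := DClassLE D.1 C.1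

variable {M} in
/-- The vertices `C` and `D` have the same labels, i.e. the same rank (the rank of any element) and
isomorphic structure groups (the `𝓗`-class of any idempotent). -/
def Vertex.SameLabels {B R F : Type*} {N : Automaton B R F} (C : M.Vertex) (D : N.Vertex) : Prop :=
  (∀ s ∈ C.1, ∀ t ∈ D.1, s.rank = t.rank) ∧
    ∀ (e : {e : M.TransitionSemigroup // IsIdempotentElem e})
      (f : {f : N.TransitionSemigroup // IsIdempotentElem f}),
      e.1 ∈ C.1 → f.1 ∈ D.1 → Nonempty (HClass e ≃* HClass f)

variable {M} in
/-- Isomorphism, as labelled graphs, between the full subgraph of the syntactic graph of `M` on the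
set of vertices `U` and the full subgraph of the syntactic graph of `N` on the set of
vertices `V`. -/
def IsomorphicOn {B R F : Type*} {N : Automaton B R F} (U : Set M.Vertex) (V : Set N.Vertex) :
    Prop :=
  ∃ f : U ≃ V, (∀ C D : U, C.1.Edge D.1 ↔ (f C).1.Edge (f D).1) ∧
    ∀ C : U, C.1.SameLabels (f C).1

/-- The set of vertices of nonzero rank. -/
def nonNullVertices : Set M.Vertex := {C | ∀ s ∈ C.1, s.rank ≠ 0}

/-- The syntactic graphs of `M` and `N` are isomorphic. -/
def SyntacticGraphsIsomorphic {B R F : Type*} (N : Automaton B R F) : Prop :=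
  IsomorphicOn (Set.univ : Set M.Vertex) (Set.univ : Set N.Vertex)

/-- The syntactic graphs of `M` and `N`, restricted to the vertices of nonzero rank, are
isomorphic. -/
def NonNullSyntacticGraphsIsomorphic {B R F : Type*} (N : Automaton B R F) : Prop :=
  IsomorphicOn M.nonNullVertices N.nonNullVertices

/-- The transition semigroup of `M` contains the empty partial map, the element of rank `0`. -/
def HasZero : Prop := ∃ s : M.TransitionSemigroup, s.rank = 0

end Automaton

end SymbolicAutomata

/-!
The proof compares the idempotents of the two transition semigroups through the periodic label
sequences that they read.

In any semigroup `S`, let the morphisms from an idempotent `e` to an idempotent `f` be the elements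
of `e S f` (`IsLocal`). Then `e 𝓓 f` means that `e` and `f` are isomorphic, `e ≤_𝓙 f` that `e` is a
retract of `f`, and the `𝓗`-class of `e` is its group of automorphisms (`greenD_idem_iff`,
`jle_idem_iff`, `greenH_iff_isLocal`). It therefore suffices to match the morphisms between nonzero
idempotents of `S(M)` with those of `S(N)`, compatibly with products.

Let `e` be an idempotent defined by a word `w`. Since `M` is deterministic and `e` is idempotent, a
biinfinite path labelled by `…www…` is determined by its state at time `0`, and these states are
exactly the elements of the image of `e` (`Reads.path_ext`, `Reads.exists_path`). The conjugacy
carries `…www…` to a sequence `…vvv…` with the same period, and some power of `v` defines an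
idempotent `f` of `S(N)`. Such a pair is a `Link`; the conjugacy of the edge shifts restricts to a
bijection from the image of `e` onto the image of `f`, so that the ranks are equal.

Let `u` be a word defining a nonzero morphism `s` from `e` to `e'`. The paths labelled by
`…wwu w'w'…` correspond to the transitions of `s` from the image of `e` to the image of `e'`.
The conjugacy is a sliding block code, hence the image of this label sequence agrees with `…vvv…`
far to the left and with `…v'v'v'…` far to the right; its central part defines a morphism from `f`
to `f'` which acts as `s` does, up to the bijections between the images (`Link.exists_match`). A
matching morphism is unique, and matching respects products (`Link.Match.eq`, `Link.Match.mul`).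
Nonzeroness of `s` is essential: without a biinfinite path there is nothing for the conjugacy to
transport. This is why the vertex of rank zero escapes the correspondence. That vertex lies below
all the others and has a trivial group, so it can be added on both sides when both have one.
-/

namespace SymbolicAutomata

/-! ### Green's relations and idempotents -/

section Green

variable {S : Type*} [Semigroup S]

/-- The relation `𝓡 ∘ 𝓛` is contained in `𝓛 ∘ 𝓡`, so that `𝓓` is an equivalence relation. -/
theorem GreenR.comp_greenL {s t u : S} (h1 : GreenR s u) (h2 : GreenL u t) : GreenD s t := by
  obtain ⟨⟨y', hy'⟩, y, hy⟩ := (greenR_iff s u).1 h1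
  obtain ⟨⟨x', hx'⟩, x, hx⟩ := (greenL_iff u t).1 h2
  obtain ⟨v, hv⟩ : ∃ v : S, (v : WithOne S) = x * s := by
    refine WithOne.cases_on x ⟨s, by simp⟩ fun a => ⟨a * s, by simp⟩
  refine ⟨v, (greenL_iff s v).2 ⟨⟨x', ?_⟩, x, hv.symm⟩, (greenR_iff v t).2 ⟨⟨y', ?_⟩, y, ?_⟩⟩
  · rw [hv, ← hy', ← mul_assoc x, hx, ← mul_assoc, hx']
  · rw [hv, ← hx, mul_assoc, hy']
  · rw [hv, mul_assoc, hy, hx]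

theorem GreenD.refl (s : S) : GreenD s s := ⟨s, rfl, rfl⟩

theorem GreenD.symm {s t : S} (h : GreenD s t) : GreenD t s := by
  obtain ⟨u, h1, h2⟩ := h
  exact GreenR.comp_greenL (Eq.symm h2) (Eq.symm h1)

theorem GreenD.trans {s t r : S} (h : GreenD s t) (h' : GreenD t r) : GreenD s r := by
  obtain ⟨u, h1, h2⟩ := h
  obtain ⟨w, h3, h4⟩ := h'
  obtain ⟨v, h5, h6⟩ := GreenR.comp_greenL h2 h3
  exact ⟨v, Eq.trans h1 h5, Eq.trans h6 h4⟩

theorem jle_iff {s t : S} :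
    JLE s t ↔ ∃ x y : WithOne S, x * (t : WithOne S) * y = (s : WithOne S) := by
  constructor
  · intro h
    obtain ⟨⟨x, y⟩, hxy⟩ := h (show (s : WithOne S) ∈ _ from ⟨(1, 1), by simp⟩)
    exact ⟨x, y, hxy⟩
  · rintro ⟨x, y, h⟩ _ ⟨⟨a, b⟩, rfl⟩
    exact ⟨(a * x, y * b), by simp only [← h, mul_assoc]⟩

theorem JLE.trans {s t r : S} (h : JLE s t) (h' : JLE t r) : JLE s r := Set.Subset.trans h h'

theorem GreenD.jle {s t : S} (h : GreenD s t) : JLE s t := by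
  obtain ⟨u, h1, h2⟩ := h
  obtain ⟨⟨x, hx⟩, -⟩ := (greenL_iff s u).1 h1
  obtain ⟨⟨y, hy⟩, -⟩ := (greenR_iff u t).1 h2
  exact jle_iff.2 ⟨x, y, by rw [mul_assoc, hy, hx]⟩

/-- `a` belongs to `e S f`, that is, `a` is a morphism between the idempotents `e` and `f` in the
Karoubi envelope of `S`. -/
def IsLocal (e f a : S) : Prop := e * a = a ∧ a * f = a

theorem IsLocal.mul {e f g a b : S} (ha : IsLocal e f a) (hb : IsLocal f g b) :
    IsLocal e g (a * b) :=
  ⟨by rw [← mul_assoc, ha.1], by rw [mul_assoc, hb.2]⟩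

theorem isLocal_of_idem {e : S} (he : IsIdempotentElem e) : IsLocal e e e := ⟨he, he⟩

theorem exists_coe_eq_mul_mul (e f : S) (x : WithOne S) :
    ∃ a : S, (a : WithOne S) = e * x * f :=
  WithOne.cases_on x ⟨e * f, by simp⟩ fun a => ⟨e * a * f, by simp⟩

/-- `e ≤_𝓙 f` if and only if `e` is a retract of `f` in the Karoubi envelope. -/
theorem jle_idem_iff {e f : S} (he : IsIdempotentElem e) (hf : IsIdempotentElem f) :
    JLE e f ↔ ∃ a b, IsLocal e f a ∧ IsLocal f e b ∧ a * b = e := by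
  have he' : (e : WithOne S) * e = e := by exact_mod_cast congrArg WithOne.coe he
  have hf' : (f : WithOne S) * f = f := by exact_mod_cast congrArg WithOne.coe hf
  constructor
  · intro h
    obtain ⟨x, y, h⟩ := jle_iff.1 h
    obtain ⟨a, ha⟩ := exists_coe_eq_mul_mul e f x
    obtain ⟨b, hb⟩ := exists_coe_eq_mul_mul f e y
    refine ⟨a, b, ⟨?_, ?_⟩, ⟨?_, ?_⟩, ?_⟩ <;> apply WithOne.coe_injective <;>
      simp only [WithOne.coe_mul, ha, hb]
    · rw [← mul_assoc, ← mul_assoc, he']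
    · rw [mul_assoc, hf']
    · rw [← mul_assoc, ← mul_assoc, hf']
    · rw [mul_assoc, he']
    · calc (e : WithOne S) * x * f * (f * y * e) = e * (x * (f * f) * y) * e := by
            simp only [mul_assoc]
        _ = e := by rw [hf', h, he', he']
  · rintro ⟨a, b, ha, hb, h⟩
    refine jle_iff.2 ⟨a, b, ?_⟩
    rw [← WithOne.coe_mul, ha.2, ← WithOne.coe_mul, h]

/-- `e 𝓓 f` if and only if `e` and `f` are isomorphic in the Karoubi envelope. -/
theorem greenD_idem_iff {e f : S} (he : IsIdempotentElem e) (hf : IsIdempotentElem f) :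
    GreenD e f ↔ ∃ a b, IsLocal e f a ∧ IsLocal f e b ∧ a * b = e ∧ b * a = f := by
  have he' : (e : WithOne S) * e = e := by exact_mod_cast congrArg WithOne.coe he
  have hf' : (f : WithOne S) * f = f := by exact_mod_cast congrArg WithOne.coe hf
  constructor
  · rintro ⟨u, h1, h2⟩
    obtain ⟨⟨y, hy⟩, x, hx⟩ := (greenL_iff e u).1 h1
    obtain ⟨⟨c, hc⟩, z, hz⟩ := (greenR_iff u f).1 h2
    obtain ⟨a, ha⟩ := exists_coe_eq_mul_mul e f y
    have hue : (u : WithOne S) * e = u := by rw [← hx, mul_assoc, he']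
    have hfu : (f : WithOne S) * u = u := by rw [← hc, ← mul_assoc, hf']
    refine ⟨a, u, ⟨?_, ?_⟩, ⟨?_, ?_⟩, ?_, ?_⟩ <;> apply WithOne.coe_injective <;>
      simp only [WithOne.coe_mul, ha]
    · rw [← mul_assoc, ← mul_assoc, he']
    · rw [mul_assoc, hf']
    · exact hfu
    · exact hue
    · rw [mul_assoc, hfu, mul_assoc, hy, he']
    · calc (u : WithOne S) * (e * y * f) = u * e * y * f := by simp only [mul_assoc]
        _ = u * (y * u) * z := by rw [hue, ← hz]; simp only [mul_assoc]
        _ = f := by rw [hy, hue, hz]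
  · rintro ⟨a, b, ha, hb, h, h'⟩
    refine ⟨b, (greenL_iff e b).2 ⟨⟨a, ?_⟩, b, ?_⟩, (greenR_iff b f).2 ⟨⟨b, ?_⟩, a, ?_⟩⟩ <;>
      rw [← WithOne.coe_mul]
    · rw [h]
    · rw [hb.2]
    · rw [hb.1]
    · rw [h']

theorem HClass.coe_one (e : {e : S // IsIdempotentElem e}) : (1 : HClass e).1 = e.1 := rfl

theorem HClass.isLocal {e : {e : S // IsIdempotentElem e}} (s : HClass e) :
    IsLocal e.1 e.1 s.1 := ⟨s.2.idem_mul e.2, s.2.mul_idem e.2⟩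

/-- The `𝓗`-class of `e` is the group of automorphisms of `e` in the Karoubi envelope. -/
theorem greenH_iff_isLocal {s e : S} (he : IsIdempotentElem e) :
    GreenH s e ↔ IsLocal e e s ∧ ∃ t, IsLocal e e t ∧ t * s = e ∧ s * t = e := by
  rw [greenH_idem_iff he]
  simp only [IsLocal, and_assoc]

/-- Let `r` be a relation between the monoids `e S e` and `f T f` which relates `e` with `f`, is
compatible with products, and relates each element of either monoid with at most one element of the
other. If every element of either `𝓗`-class is related with an element of the other monoid, then
`r` induces an isomorphism between the two `𝓗`-classes: an element related with a unit is a
unit. -/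
theorem HClass.nonempty_mulEquiv_of_rel {T : Type*} [Semigroup T]
    (e : {e : S // IsIdempotentElem e}) (f : {f : T // IsIdempotentElem f})
    (r : S → T → Prop) (hone : r e.1 f.1)
    (hmul : ∀ s t s' t', IsLocal e.1 e.1 s → IsLocal f.1 f.1 t → IsLocal e.1 e.1 s' →
      IsLocal f.1 f.1 t' → r s t → r s' t' → r (s * s') (t * t'))
    (hex : ∀ s : HClass e, ∃ t, IsLocal f.1 f.1 t ∧ r s.1 t)
    (hex' : ∀ t : HClass f, ∃ s, IsLocal e.1 e.1 s ∧ r s t.1)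
    (huniq : ∀ s t t', IsLocal f.1 f.1 t → IsLocal f.1 f.1 t' → r s t → r s t' → t = t')
    (huniq' : ∀ s s' t, IsLocal e.1 e.1 s → IsLocal e.1 e.1 s' → r s t → r s' t → s = s') :
    Nonempty (HClass e ≃* HClass f) := by
  have key : ∀ s : HClass e, ∃ t : HClass f, r s.1 t.1 := by
    intro s
    obtain ⟨t, ht, hst⟩ := hex s
    obtain ⟨t', ht', hst'⟩ := hex s⁻¹
    refine ⟨⟨t, (greenH_iff_isLocal f.2).2 ⟨ht, t', ht', ?_, ?_⟩⟩, hst⟩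
    · refine huniq e.1 _ _ (ht'.mul ht) (isLocal_of_idem f.2) ?_ hone
      rw [← HClass.coe_one e, ← inv_mul_cancel s]
      exact hmul _ _ _ _ (s⁻¹).isLocal ht' s.isLocal ht hst' hst
    · refine huniq e.1 _ _ (ht.mul ht') (isLocal_of_idem f.2) ?_ hone
      rw [← HClass.coe_one e, ← mul_inv_cancel s]
      exact hmul _ _ _ _ s.isLocal ht (s⁻¹).isLocal ht' hst hst'
  have key' : ∀ t : HClass f, ∃ s : HClass e, r s.1 t.1 := by
    intro s
    obtain ⟨t, ht, hst⟩ := hex' s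
    obtain ⟨t', ht', hst'⟩ := hex' s⁻¹
    refine ⟨⟨t, (greenH_iff_isLocal e.2).2 ⟨ht, t', ht', ?_, ?_⟩⟩, hst⟩
    · refine huniq' _ _ f.1 (ht'.mul ht) (isLocal_of_idem e.2) ?_ hone
      rw [← HClass.coe_one f, ← inv_mul_cancel s]
      exact hmul _ _ _ _ ht' (s⁻¹).isLocal ht s.isLocal hst' hst
    · refine huniq' _ _ f.1 (ht.mul ht') (isLocal_of_idem e.2) ?_ hone
      rw [← HClass.coe_one f, ← mul_inv_cancel s]
      exact hmul _ _ _ _ ht s.isLocal ht' (s⁻¹).isLocal hst hst'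
  choose φ hφ using key
  refine ⟨MulEquiv.ofBijective
    (MulHom.mk φ fun s s' => Subtype.ext ?_) ⟨fun s s' h => Subtype.ext ?_, fun t => ?_⟩⟩
  · exact huniq _ _ _ (φ (s * s')).isLocal (φ s * φ s').isLocal (hφ _)
      (hmul _ _ _ _ s.isLocal (φ s).isLocal s'.isLocal (φ s').isLocal (hφ s) (hφ s'))
  · refine huniq' _ _ (φ s).1 s.isLocal s'.isLocal (hφ s) ?_
    have h' : φ s = φ s' := h
    rw [h']
    exact hφ s'
  · obtain ⟨s, hs⟩ := key' t
    exact ⟨s, Subtype.ext (huniq _ _ _ (φ s).isLocal t.isLocal (hφ s) hs)⟩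

/-- Conjugation by an isomorphism of the Karoubi envelope identifies the structure groups of the
idempotents of a `𝓓`-class. -/
theorem GreenD.nonempty_mulEquiv {e f : {e : S // IsIdempotentElem e}} (h : GreenD e.1 f.1) :
    Nonempty (HClass e ≃* HClass f) := by
  obtain ⟨a, b, ha, hb, hab, hba⟩ := (greenD_idem_iff e.2 f.2).1 h
  refine HClass.nonempty_mulEquiv_of_rel e f (fun s t => s * a = a * t) ?_ ?_ ?_ ?_ ?_ ?_
  · rw [ha.1, ha.2]
  · intro s t s' t' _ _ _ _ h h'
    rw [mul_assoc, h', ← mul_assoc, h, mul_assoc]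
  · intro s
    refine ⟨b * s.1 * a, (hb.mul s.isLocal).mul ha, ?_⟩
    rw [← mul_assoc, ← mul_assoc, hab, s.isLocal.1]
  · intro t
    refine ⟨a * t.1 * b, (ha.mul t.isLocal).mul hb, ?_⟩
    rw [mul_assoc, hba, mul_assoc, t.isLocal.2]
  · intro s t t' ht ht' h h'
    rw [← ht.1, ← ht'.1, ← hba, mul_assoc, ← h, h', mul_assoc]
  · intro s s' t hs hs' h h'
    rw [← hs.2, ← hs'.2, ← hab, ← mul_assoc, h, ← h', mul_assoc]

theorem IsRegularDClass.greenD {C : Set S} (hC : IsRegularDClass C) {s t : S} (hs : s ∈ C)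
    (ht : t ∈ C) : GreenD s t := by
  obtain ⟨⟨r, rfl⟩, -⟩ := hC
  exact GreenD.trans (GreenD.symm hs) ht

theorem IsRegularDClass.mem_of_greenD {C : Set S} (hC : IsRegularDClass C) {s t : S} (hs : s ∈ C)
    (h : GreenD s t) : t ∈ C := by
  obtain ⟨⟨r, rfl⟩, -⟩ := hC
  exact GreenD.trans hs h

theorem IsRegularDClass.eq {C D : Set S} (hC : IsRegularDClass C) (hD : IsRegularDClass D)
    {s t : S} (hs : s ∈ C) (ht : t ∈ D) (h : GreenD s t) : C = D := by
  ext r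
  constructor
  · intro hr
    exact hD.mem_of_greenD ht (h.symm.trans (hC.greenD hs hr))
  · intro hr
    exact hC.mem_of_greenD hs (h.trans (hD.greenD ht hr))

theorem isRegularDClass_of_idem {e : S} (he : IsIdempotentElem e) :
    IsRegularDClass {t | GreenD e t} := ⟨⟨e, rfl⟩, e, GreenD.refl e, he⟩

end Green

namespace Automaton

/-! ### Ranks of elements of the transition semigroup -/

section TransitionSemigroup

variable {A Q E : Type*} {M : Automaton A Q E}

theorem TransitionSemigroup.mem_mul {s t : M.TransitionSemigroup} {p q : Q} :
    q ∈ (s * t).1 p ↔ ∃ r ∈ s.1 p, q ∈ t.1 r :=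
  Part.mem_bind_iff

theorem TransitionSemigroup.ext {s t : M.TransitionSemigroup}
    (h : ∀ p q, q ∈ s.1 p ↔ q ∈ t.1 p) : s = t :=
  Subtype.ext (PFun.ext h)

theorem TransitionSemigroup.rank_mul_le_left [Finite Q] (s t : M.TransitionSemigroup) :
    (s * t).rank ≤ s.rank := by
  classical
  -- `t` maps the image of `s` onto the image of `s * t`
  have hsub : Part.some '' (s * t).1.ran ⊆ t.1 '' s.1.ran := by
    rintro _ ⟨q, ⟨p, hp⟩, rfl⟩
    obtain ⟨r, hr, hq⟩ := mem_mul.1 hp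
    exact ⟨r, ⟨p, hr⟩, Part.eq_some_iff.2 hq⟩
  calc (s * t).1.ran.ncard = (Part.some '' (s * t).1.ran).ncard :=
        (Set.ncard_image_of_injective _ Part.some_injective).symm
    _ ≤ (t.1 '' s.1.ran).ncard := Set.ncard_le_ncard hsub ((Set.toFinite _).image _)
    _ ≤ s.1.ran.ncard := Set.ncard_image_le (Set.toFinite _)

theorem TransitionSemigroup.rank_mul_le_right [Finite Q] (s t : M.TransitionSemigroup) :
    (s * t).rank ≤ t.rank := by
  refine Set.ncard_le_ncard ?_ (Set.toFinite _)
  rintro q ⟨p, hp⟩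
  obtain ⟨r, -, hq⟩ := mem_mul.1 hp
  exact ⟨r, hq⟩

theorem TransitionSemigroup.rank_ne_zero_of_mul [Finite Q] {s t : M.TransitionSemigroup}
    (h : (s * t).rank ≠ 0) : s.rank ≠ 0 ∧ t.rank ≠ 0 := by
  have h1 := rank_mul_le_left s t
  have h2 := rank_mul_le_right s t
  exact ⟨by omega, by omega⟩

theorem TransitionSemigroup.rank_le_of_jle [Finite Q] {s t : M.TransitionSemigroup}
    (h : JLE s t) : s.rank ≤ t.rank := by
  obtain ⟨x, y, h⟩ := jle_iff.1 h
  revert h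
  refine WithOne.cases_on x ?_ fun x => ?_ <;> refine WithOne.cases_on y ?_ fun y => ?_ <;> intro h
  · rw [one_mul, mul_one, WithOne.coe_inj] at h
    rw [h]
  · rw [one_mul, ← WithOne.coe_mul, WithOne.coe_inj] at h
    exact h ▸ rank_mul_le_left _ _
  · rw [mul_one, ← WithOne.coe_mul, WithOne.coe_inj] at h
    exact h ▸ rank_mul_le_right _ _
  · rw [← WithOne.coe_mul, ← WithOne.coe_mul, WithOne.coe_inj] at h
    exact h ▸ (rank_mul_le_left _ _).trans (rank_mul_le_right _ _)

theorem TransitionSemigroup.rank_eq_of_greenD [Finite Q] {s t : M.TransitionSemigroup}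
    (h : GreenD s t) : s.rank = t.rank :=
  le_antisymm (rank_le_of_jle h.jle) (rank_le_of_jle h.symm.jle)

theorem TransitionSemigroup.rank_eq_zero_iff [Finite Q] {s : M.TransitionSemigroup} :
    s.rank = 0 ↔ ∀ p q, q ∉ s.1 p := by
  rw [rank, Set.ncard_eq_zero (Set.toFinite _), Set.eq_empty_iff_forall_notMem]
  exact ⟨fun h p q hq => h q ⟨p, hq⟩, fun h q ⟨p, hq⟩ => h p q hq⟩

theorem TransitionSemigroup.eq_of_rank_eq_zero [Finite Q] {s t : M.TransitionSemigroup}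
    (hs : s.rank = 0) (ht : t.rank = 0) : s = t :=
  TransitionSemigroup.ext fun p q =>
    ⟨fun h => absurd h (rank_eq_zero_iff.1 hs p q), fun h => absurd h (rank_eq_zero_iff.1 ht p q)⟩

theorem TransitionSemigroup.mem_ran_idem_iff {e : M.TransitionSemigroup}
    (he : IsIdempotentElem e) {p : Q} : p ∈ e.1.ran ↔ p ∈ e.1 p := by
  refine ⟨?_, fun h => ⟨p, h⟩⟩
  rintro ⟨r, hr⟩
  rw [← he.eq] at hr
  obtain ⟨p', h1, h2⟩ := mem_mul.1 hr
  rw [he.eq] at hr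
  rwa [Part.mem_unique h1 hr] at h2

end TransitionSemigroup

/-! ### Biinfinite paths of a deterministic automaton -/

/-- The word `a i, a (i + 1), …, a (i + n - 1)`. -/
def word {A : Type*} (a : ℤ → A) (i : ℤ) : ℕ → List A
  | 0 => []
  | n + 1 => word a i n ++ [a (i + n)]

theorem word_add {A : Type*} (a : ℤ → A) (i : ℤ) (m n : ℕ) :
    word a i (m + n) = word a i m ++ word a (i + m) n := by
  induction n with
  | zero => simp [word]
  | succ n ih => simp [word, ← add_assoc, ih]

theorem word_congr {A : Type*} {a b : ℤ → A} {i j : ℤ} {n : ℕ}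
    (h : ∀ k : ℕ, k < n → a (i + k) = b (j + k)) : word a i n = word b j n := by
  induction n with
  | zero => rfl
  | succ n ih => rw [word, word, ih fun k hk => h k (by omega), h n (by omega)]

theorem word_ne_nil {A : Type*} (a : ℤ → A) (i : ℤ) {n : ℕ} (hn : 0 < n) : word a i n ≠ [] := by
  obtain ⟨n, rfl⟩ := Nat.exists_eq_succ_of_ne_zero hn.ne'
  simp [word]

theorem word_eq {A : Type*} (a : ℤ → A) (i : ℤ) (w : List A)
    (h : ∀ k : ℕ, (hk : k < w.length) → a (i + k) = w[k]) : word a i w.length = w := by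
  induction w using List.reverseRecOn with
  | nil => rfl
  | append_singleton w c ih =>
    rw [List.length_append, List.length_singleton, word, ih, h w.length (by simp)]
    · simp
    · intro k hk
      rw [h k (by simp; omega), List.getElem_append_left hk]

section Paths

variable {A Q E : Type*} (M : Automaton A Q E)

/-- `x` is a biinfinite path of `M`. -/
def IsPath (x : ℤ → E) : Prop := ∀ n, M.tgt (x n) = M.src (x (n + 1))

theorem act_word_succ (a : ℤ → A) (i : ℤ) (n : ℕ) :
    M.act (word a i (n + 1)) = (M.step (a (i + n))).comp (M.act (word a i n)) := by
  rw [word, act_append]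
  simp [act, PFun.id_comp]

variable {M}

/-- A finite path labelled by a window of `a`, as a sequence of states. -/
theorem exists_states_of_mem_act {a : ℤ → A} {i : ℤ} {n : ℕ} {p q : Q}
    (h : q ∈ M.act (word a i n) p) :
    ∃ σ : ℤ → Q, σ i = p ∧ σ (i + n) = q ∧
      ∀ j, i ≤ j → j < i + n → σ (j + 1) ∈ M.step (a j) (σ j) := by
  classical
  induction n generalizing q with
  | zero =>
    refine ⟨fun _ => p, rfl, ?_, fun j h1 h2 => by simp at h2; omega⟩
    exact (Part.mem_some_iff.1 h).symm
  | succ n ih =>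
    rw [act_word_succ] at h
    obtain ⟨r, hr, hq⟩ := Part.mem_bind_iff.1 h
    obtain ⟨σ, h1, h2, h3⟩ := ih hr
    refine ⟨Function.update σ (i + n + 1) q, ?_, ?_, ?_⟩
    · rw [Function.update_of_ne (by omega), h1]
    · push_cast
      rw [← add_assoc, Function.update_self]
    · intro j hj hj'
      rw [Function.update_of_ne (by omega : j ≠ i + n + 1)]
      by_cases hjn : j = i + n
      · rw [hjn, Function.update_self, h2]
        exact hq
      · rw [Function.update_of_ne (by omega)]
        exact h3 j hj (by push_cast at hj'; omega)

theorem IsDeterministic.exists_path (hM : M.IsDeterministic) {a : ℤ → A} {τ : ℤ → Q}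
    (h : ∀ n, τ (n + 1) ∈ M.step (a n) (τ n)) :
    ∃ x, M.IsPath x ∧ (∀ n, M.lab (x n) = a n) ∧ ∀ n, M.src (x n) = τ n := by
  choose x h1 h2 h3 using fun n => (hM.mem_step_iff _ _ _).1 (h n)
  exact ⟨x, fun n => (h3 n).trans (h1 (n + 1)).symm, h2, h1⟩

theorem IsPath.mem_act (hM : M.IsDeterministic) {x : ℤ → E} (hx : M.IsPath x) (i : ℤ) (n : ℕ) :
    M.src (x (i + n)) ∈ M.act (word (fun j => M.lab (x j)) i n) (M.src (x i)) := by
  induction n with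
  | zero => simp [word, act]
  | succ n ih =>
    rw [act_word_succ]
    refine Part.mem_bind_iff.2 ⟨_, ih, (hM.mem_step_iff _ _ _).2 ⟨x (i + n), rfl, rfl, ?_⟩⟩
    rw [hx, Nat.cast_succ, add_assoc]

theorem IsPath.mem_act_of_lab (hM : M.IsDeterministic) {x : ℤ → E} (hx : M.IsPath x) {a : ℤ → A}
    {i : ℤ} {n : ℕ} (h : ∀ k : ℕ, k < n → M.lab (x (i + k)) = a (i + k)) :
    M.src (x (i + n)) ∈ M.act (word a i n) (M.src (x i)) := by
  rw [← word_congr (a := fun j => M.lab (x j)) h]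
  exact hx.mem_act hM i n

/-- Two paths of a deterministic automaton which pass through the same state at time `i` and have
the same labels from then on coincide from then on. -/
theorem IsPath.eq_of_src_eq (hM : M.IsDeterministic) {x y : ℤ → E} (hx : M.IsPath x)
    (hy : M.IsPath y) {i : ℤ} (hi : M.src (x i) = M.src (y i)) {m : ℤ}
    (h : ∀ n, i ≤ n → n < m → M.lab (x n) = M.lab (y n)) {n : ℤ} (h1 : i ≤ n) :
    (n ≤ m → M.src (x n) = M.src (y n)) ∧ (n < m → x n = y n) := by
  have key : n ≤ m → M.src (x n) = M.src (y n) := by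
    induction n, h1 using Int.leInduction with
    | base => exact fun _ => hi
    | succ n hn ih =>
      intro hm
      rw [← hx, ← hy, hM _ _ (ih (by omega)) (h n hn (by omega))]
  exact ⟨key, fun hm => hM _ _ (key hm.le) (h n h1 hm)⟩

/-- The left part of `x` can be joined to the right part of `y` by a finite path. -/
theorem IsPath.exists_glue (hM : M.IsDeterministic) {x y : ℤ → E} (hx : M.IsPath x)
    (hy : M.IsPath y) {a : ℤ → A} {i : ℤ} {m : ℕ} (hxa : ∀ n < i, M.lab (x n) = a n)
    (hya : ∀ n, i + m ≤ n → M.lab (y n) = a n)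
    (h : M.src (y (i + m)) ∈ M.act (word a i m) (M.src (x i))) :
    ∃ z, M.IsPath z ∧ (∀ n, M.lab (z n) = a n) ∧ (∀ n < i, z n = x n) ∧
      ∀ n, i + m ≤ n → z n = y n := by
  obtain ⟨σ, h1, h2, h3⟩ := exists_states_of_mem_act h
  obtain ⟨z, hz, hza, hzs⟩ := hM.exists_path (a := a)
    (τ := fun n => if n < i then M.src (x n) else if n < i + m then σ n else M.src (y n)) (by
      intro n
      rcases lt_or_ge n i with hn | hn
      · have hstep : M.src (x (n + 1)) ∈ M.step (a n) (M.src (x n)) :=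
          (hM.mem_step_iff _ _ _).2 ⟨x n, rfl, hxa n hn, hx n⟩
        rcases lt_or_ge (n + 1) i with hn' | hn'
        · simpa [hn, hn'] using hstep
        · obtain rfl : n + 1 = i := by omega
          rcases Nat.eq_zero_or_pos m with rfl | hm
          · simp only [Nat.cast_zero, add_zero] at h2 ⊢
            simpa [← h2, h1] using hstep
          · simpa [hm, h1] using hstep
      · rcases lt_or_ge n (i + m) with hn' | hn'
        · have hstep := h3 n hn hn'
          rcases lt_or_ge (n + 1) (i + m) with hn'' | hn''
          · simpa [not_lt.2 hn, hn', hn'', show ¬ n + 1 < i by omega] using hstep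
          · obtain hni : n + 1 = i + m := by omega
            rw [hni, h2] at hstep
            simpa [not_lt.2 hn, hn', hni, show ¬ (m : ℤ) < 0 by omega] using hstep
        · have hstep : M.src (y (n + 1)) ∈ M.step (a n) (M.src (y n)) :=
            (hM.mem_step_iff _ _ _).2 ⟨y n, rfl, hya n hn', hy n⟩
          simpa [not_lt.2 hn, not_lt.2 hn', show ¬ n + 1 < i by omega,
            show ¬ n + 1 < i + m by omega] using hstep)
  refine ⟨z, hz, hza, fun n hn => hM _ _ ?_ ?_, fun n hn => hM _ _ ?_ ?_⟩
  · rw [hzs, if_pos hn]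
  · rw [hza, hxa n hn]
  · rw [hzs, if_neg (by omega), if_neg (by omega)]
  · rw [hza, hya n hn]

/-- A cycle labelled by a period of the periodic sequence `a` extends to a biinfinite path. -/
theorem IsDeterministic.exists_periodic_path (hM : M.IsDeterministic) {a : ℤ → A} {L : ℕ}
    (hL : 0 < L) (ha : Function.Periodic a (L : ℤ)) {p : Q} (h : p ∈ M.act (word a 0 L) p) :
    ∃ x, M.IsPath x ∧ (∀ n, M.lab (x n) = a n) ∧ M.src (x 0) = p := by
  obtain ⟨σ, h1, h2, h3⟩ := exists_states_of_mem_act h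
  have hL' : (0 : ℤ) < L := by exact_mod_cast hL
  rw [zero_add] at h2 h3
  obtain ⟨x, hx, hxa, hxs⟩ := hM.exists_path (a := a) (τ := fun n => σ (n % L)) (by
    intro n
    have hm := h3 (n % L) (Int.emod_nonneg _ hL'.ne') (Int.emod_lt_of_pos _ hL')
    have han : a (n % L) = a n := by
      rw [Int.emod_def, mul_comm]
      exact ha.sub_int_mul_eq _
    rw [han] at hm
    suffices h : σ ((n + 1) % L) = σ (n % L + 1) by rwa [h]
    by_cases hlast : n % L + 1 = L
    · have h0 : (n + 1) % L = 0 := by rw [← Int.emod_add_emod, hlast, Int.emod_self]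
      rw [h0, hlast, h1, h2]
    · have hlt := Int.emod_lt_of_pos n hL'
      have hnn := Int.emod_nonneg n hL'.ne'
      rw [← Int.emod_add_emod, Int.emod_eq_of_lt (by omega) (by omega)])
  refine ⟨x, hx, hxa, ?_⟩
  rw [hxs, Int.zero_emod, h1]

/-! ### Paths with a periodic label -/

/-- `Reads e a L` means that `a` has period `L > 0` and that the idempotent `e` is the partial map
defined by the word formed of one period of `a`. -/
structure Reads (e : M.TransitionSemigroup) (a : ℤ → A) (L : ℕ) : Prop where
  idem : IsIdempotentElem e
  pos : 0 < L
  periodic : Function.Periodic a (L : ℤ)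
  act_eq : M.act (word a 0 L) = e.1

namespace Reads

variable {e : M.TransitionSemigroup} {a : ℤ → A} {L : ℕ} (he : Reads e a L)

include he

theorem act_word (k : ℤ) : M.act (word a (k * L) L) = e.1 := by
  rw [← he.act_eq]
  congr 1
  refine word_congr fun j _ => ?_
  rw [zero_add, add_comm]
  exact (he.periodic.int_mul k) j

theorem exists_path (hM : M.IsDeterministic) {p : Q} (hp : p ∈ e.1 p) :
    ∃ x, M.IsPath x ∧ (∀ n, M.lab (x n) = a n) ∧ M.src (x 0) = p :=
  hM.exists_periodic_path he.pos he.periodic (he.act_eq ▸ hp)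

/-- A path whose labels at negative times are those of `a` passes through the same state at all
the times `0, -L, -2L, …`, since `e` is idempotent. -/
theorem src_neg (hM : M.IsDeterministic) {x : ℤ → E} (hx : M.IsPath x)
    (h : ∀ n < 0, M.lab (x n) = a n) (k : ℕ) :
    M.src (x (-(k * L : ℤ))) = M.src (x 0) ∧ M.src (x 0) ∈ e.1 (M.src (x 0)) := by
  have hstep (k : ℕ) :
      M.src (x (-(k * L : ℤ))) ∈ e.1 (M.src (x (-((k + 1 : ℕ) * L : ℤ)))) := by
    have h1 : -((k + 1 : ℕ) * L : ℤ) + L = -(k * L : ℤ) := by push_cast; ring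
    have h2 := hx.mem_act_of_lab hM (a := a) (i := -((k + 1 : ℕ) * L : ℤ)) (n := L) (by
      intro j hj
      refine h _ ?_
      push_cast
      have : (0 : ℤ) ≤ k * L := by positivity
      have hj' : (j : ℤ) < L := by exact_mod_cast hj
      linarith)
    have h3 := he.act_word (-(k + 1 : ℕ))
    rw [neg_mul] at h3
    rwa [h3, h1] at h2
  have hfix (k : ℕ) : M.src (x (-(k * L : ℤ))) ∈ e.1 (M.src (x (-(k * L : ℤ)))) :=
    (TransitionSemigroup.mem_ran_idem_iff he.idem).1 ⟨_, hstep k⟩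
  refine ⟨?_, by simpa using hfix 0⟩
  induction k with
  | zero => simp
  | succ k ih => rw [← ih, Part.mem_unique (hstep k) (hfix (k + 1))]

theorem eq_of_src_eq (hM : M.IsDeterministic) {x y : ℤ → E} (hx : M.IsPath x) (hy : M.IsPath y)
    {m : ℤ} (hm : 0 ≤ m) (hxa : ∀ n < m, M.lab (x n) = a n) (hya : ∀ n < m, M.lab (y n) = a n)
    (h : M.src (x 0) = M.src (y 0)) {n : ℤ} (hn : n < m) : x n = y n := by
  obtain ⟨k, hk⟩ : ∃ k : ℕ, -(k * L : ℤ) ≤ n := by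
    refine ⟨n.natAbs, ?_⟩
    have h1 : (1 : ℤ) ≤ L := by exact_mod_cast he.pos
    have h2 : (n.natAbs : ℤ) ≤ n.natAbs * L := le_mul_of_one_le_right (by positivity) h1
    omega
  refine (hx.eq_of_src_eq hM hy (i := -(k * L : ℤ)) ?_ (m := m) ?_ hk).2 hn
  · rw [(he.src_neg hM hx (fun n hn => hxa n (by omega)) k).1,
      (he.src_neg hM hy (fun n hn => hya n (by omega)) k).1, h]
  · intro j _ hj
    rw [hxa j hj, hya j hj]

/-- A path labelled by `a` is determined by its state at time `0`. -/
theorem path_ext (hM : M.IsDeterministic) {x y : ℤ → E} (hx : M.IsPath x) (hy : M.IsPath y)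
    (hxa : ∀ n, M.lab (x n) = a n) (hya : ∀ n, M.lab (y n) = a n)
    (h : M.src (x 0) = M.src (y 0)) : x = y :=
  funext fun n => he.eq_of_src_eq hM hx hy (m := max 0 (n + 1)) (by omega) (fun n _ => hxa n)
    (fun n _ => hya n) h (by omega)

theorem src_fixed (hM : M.IsDeterministic) {x : ℤ → E} (hx : M.IsPath x)
    (hxa : ∀ n, M.lab (x n) = a n) : M.src (x 0) ∈ e.1 (M.src (x 0)) :=
  (he.src_neg hM hx (fun n _ => hxa n) 0).2

theorem path_periodic (hM : M.IsDeterministic) {x : ℤ → E} (hx : M.IsPath x)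
    (hxa : ∀ n, M.lab (x n) = a n) : Function.Periodic x (L : ℤ) := by
  have h1 := hx.mem_act_of_lab hM (a := a) (i := 0) (n := L) (fun k _ => hxa _)
  rw [he.act_eq, zero_add] at h1
  have h2 : (fun n => x (n + L)) = x := by
    refine he.path_ext hM (fun n => ?_) hx (fun n => ?_) hxa ?_
    · rw [hx, add_right_comm]
    · rw [hxa, he.periodic]
    · rw [zero_add]
      exact Part.mem_unique h1 (he.src_fixed hM hx hxa)
  exact fun n => congrFun h2 n

/-- A path labelled by `a` at negative times coincides at negative times with a path labelled
by `a`. -/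
theorem exists_left (hM : M.IsDeterministic) {x : ℤ → E} (hx : M.IsPath x)
    (h : ∀ n < 0, M.lab (x n) = a n) :
    ∃ y, M.IsPath y ∧ (∀ n, M.lab (y n) = a n) ∧ (∀ n < 0, x n = y n) ∧
      M.src (x 0) = M.src (y 0) := by
  obtain ⟨y, hy, hya, hy0⟩ := he.exists_path hM (he.src_neg hM hx h 0).2
  exact ⟨y, hy, hya, fun n hn => he.eq_of_src_eq hM hx hy le_rfl h (fun n _ => hya n) hy0.symm hn,
    hy0.symm⟩

/-- A path labelled by `a` from time `m` on whose state at time `m` is fixed by `e` coincides from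
time `m` on with a translate of a path labelled by `a`. -/
theorem exists_right (hM : M.IsDeterministic) {x : ℤ → E} (hx : M.IsPath x) {m : ℤ}
    (h : ∀ n, m ≤ n → M.lab (x n) = a (n - m)) (hm : M.src (x m) ∈ e.1 (M.src (x m))) :
    ∃ y, M.IsPath y ∧ (∀ n, M.lab (y n) = a n) ∧ (∀ n, m ≤ n → x n = y (n - m)) ∧
      M.src (x m) = M.src (y 0) := by
  obtain ⟨y, hy, hya, hy0⟩ := he.exists_path hM hm
  refine ⟨y, hy, hya, fun n hn => ?_, hy0.symm⟩
  refine (hx.eq_of_src_eq hM (y := fun n => y (n - m)) (fun n => ?_) (i := m) ?_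
    (m := n + 1) ?_ hn).2 (by omega)
  · rw [hy, sub_add_eq_add_sub]
  · rw [sub_self, hy0]
  · intro j hj _
    rw [h j hj, hya]

end Reads

end Paths

end Automaton
end SymbolicAutomata

namespace SymbolicAutomata

/-! ### Conjugacies are invertible block maps -/

section Conjugacy

variable {A B : Type*} [TopologicalSpace A] [TopologicalSpace B] {X : Subshift A ℤ}
  {Y : Subshift B ℤ} {φ : X.carrier → Y.carrier}

theorem IsConjugacy.map_translate (h : IsConjugacy X Y φ) (m : ℤ) :
    ∀ x y : X.carrier, (∀ n, y.1 n = x.1 (n + m)) → ∀ n, (φ y).1 n = (φ x).1 (n + m) := by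
  have hone (x y : X.carrier) (hxy : ∀ n, y.1 n = x.1 (n + 1)) (n : ℤ) :
      (φ y).1 n = (φ x).1 (n + 1) := by
    have hy : y = (X.mapsTo 1).restrict _ _ _ x :=
      Subtype.ext (funext fun n => (hxy n).trans (congrArg x.1 (add_comm n 1)))
    rw [hy, h.2.2, add_comm]
    rfl
  have hnat (m : ℕ) : ∀ x y : X.carrier, (∀ n, y.1 n = x.1 (n + m)) →
      ∀ n, (φ y).1 n = (φ x).1 (n + m) := by
    induction m with
    | zero =>
      intro x y hxy n
      have : y = x := Subtype.ext (funext fun n => by simpa using hxy n)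
      rw [this]
      simp
    | succ m ih =>
      intro x y hxy n
      let z : X.carrier := (X.mapsTo 1).restrict _ _ _ x
      have hz (n : ℤ) : z.1 n = x.1 (n + 1) := congrArg x.1 (add_comm 1 n)
      rw [ih z y (fun n => by rw [hxy, hz]; push_cast; rw [add_assoc]) n, hone x z hz]
      push_cast
      rw [add_assoc]
  intro x y hxy n
  obtain ⟨m, rfl | rfl⟩ := m.eq_nat_or_neg
  · exact hnat m x y hxy n
  · rw [hnat m y x (fun n => by rw [hxy]; simp) (n + -m)]
    simp

theorem IsConjugacy.symm [Finite A] [DiscreteTopology B]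
    [DiscreteTopology A] (h : IsConjugacy X Y φ) :
    IsConjugacy Y X (Equiv.ofBijective φ h.2.1).symm := by
  have : CompactSpace X.carrier := isCompact_iff_compactSpace.1 X.isClosed.isCompact
  refine ⟨Continuous.continuous_symm_of_equiv_compact_to_t2 (f := Equiv.ofBijective φ h.2.1) h.1,
    Equiv.bijective _, fun y => ?_⟩
  rw [Equiv.symm_apply_eq]
  change _ = φ _
  rw [h.2.2]
  congr 1
  exact ((Equiv.ofBijective φ h.2.1).apply_symm_apply y).symm

/-- A continuous map from a shift space to a discrete space depends only on finitely many
coordinates. -/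
theorem exists_window [Finite A] [DiscreteTopology A] {D : Type*} [TopologicalSpace D]
    [DiscreteTopology D] {g : X.carrier → D} (hg : Continuous g) :
    ∃ k : ℕ, ∀ x y : X.carrier, (∀ j : ℤ, -k ≤ j → j ≤ k → x.1 j = y.1 j) → g x = g y := by
  have : CompactSpace X.carrier := isCompact_iff_compactSpace.1 X.isClosed.isCompact
  have hloc (x : X.carrier) : ∃ k : ℕ, ∀ y : X.carrier,
      (∀ j : ℤ, -k ≤ j → j ≤ k → x.1 j = y.1 j) → g x = g y := by
    obtain ⟨U, hU, hUg⟩ := isOpen_induced_iff.1 ((isOpen_discrete {g x}).preimage hg)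
    have hxU : x.1 ∈ U := by
      have : x ∈ Subtype.val ⁻¹' U := by rw [hUg]; rfl
      exact this
    obtain ⟨I, u, hu, hIU⟩ := isOpen_pi_iff.1 hU x.1 hxU
    obtain ⟨k, hk⟩ := (I.image Int.natAbs).bddAbove
    refine ⟨k, fun y hy => ?_⟩
    have hyU : y ∈ Subtype.val ⁻¹' U := by
      refine hIU fun j hj => ?_
      have hjk : j.natAbs ≤ k := hk (by simpa using ⟨j, hj, rfl⟩)
      rw [← hy j (by omega) (by omega)]
      exact (hu j hj).2
    rw [hUg] at hyU
    exact hyU.symm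
  choose k hk using hloc
  obtain ⟨t, ht⟩ := isCompact_univ.elim_nhds_subcover
    (fun x : X.carrier => {y | ∀ j : ℤ, -(k x) ≤ j → j ≤ k x → x.1 j = y.1 j}) (by
      intro x _
      refine IsOpen.mem_nhds ?_ fun j _ _ => rfl
      have hset : {y : X.carrier | ∀ j : ℤ, -(k x) ≤ j → j ≤ k x → x.1 j = y.1 j} =
          Subtype.val ⁻¹' cylinder (Finset.Icc (-(k x : ℤ)) (k x)) x.1 := by
        ext y
        simp only [Set.mem_ofPred_eq, Set.mem_preimage, mem_cylinder, Finset.mem_Icc, and_imp]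
        exact forall_congr' fun j => by simp only [eq_comm]
      rw [hset]
      exact (isOpen_cylinder _ _).preimage continuous_subtype_val)
  refine ⟨t.sup k, fun x y hxy => ?_⟩
  obtain ⟨z, hz, hxz⟩ : ∃ z ∈ t, x ∈ {y : X.carrier | ∀ j : ℤ, -(k z) ≤ j → j ≤ k z →
      z.1 j = y.1 j} := by
    simpa using ht.2 (Set.mem_univ x)
  have hle : k z ≤ t.sup k := Finset.le_sup hz
  rw [← hk z x hxz, ← hk z y fun j h1 h2 => ?_]
  rw [hxz j h1 h2, hxy j (by omega) (by omega)]

/-- A conjugacy is a sliding block code. -/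
theorem IsConjugacy.exists_window [Finite A] [DiscreteTopology A] [DiscreteTopology B]
    (h : IsConjugacy X Y φ) : ∃ k : ℕ, ∀ k' : ℕ, k ≤ k' → ∀ (x y : X.carrier) (n : ℤ),
      (∀ j, n - k' ≤ j → j ≤ n + k' → x.1 j = y.1 j) → (φ x).1 n = (φ y).1 n := by
  obtain ⟨k, hk⟩ := SymbolicAutomata.exists_window (X := X) (g := fun x => (φ x).1 0)
    ((continuous_apply 0).comp (continuous_subtype_val.comp h.1))
  refine ⟨k, fun k' hkk' x y n hxy => ?_⟩
  let x' : X.carrier := (X.mapsTo n).restrict _ _ _ x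
  let y' : X.carrier := (X.mapsTo n).restrict _ _ _ y
  have hx (j : ℤ) : x'.1 j = x.1 (j + n) := congrArg x.1 (add_comm n j)
  have hy (j : ℤ) : y'.1 j = y.1 (j + n) := congrArg y.1 (add_comm n j)
  have h0 := hk x' y' fun j h1 h2 => by rw [hx, hy, hxy _ (by omega) (by omega)]
  rwa [h.map_translate n x x' hx, h.map_translate n y y' hy, zero_add] at h0

end Conjugacy

namespace Automaton

variable {A B Q R E F : Type*} {M : Automaton A Q E} {N : Automaton B R F}

/-- `φ` commutes with translations and is a sliding block code with window `[-k, k]`, as is the map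
that it induces on labels of paths. -/
structure IsBlockMap (k : ℕ) (φ : {x // M.IsPath x} → {y // N.IsPath y}) : Prop where
  map_translate : ∀ (m : ℤ) (x x' : {x // M.IsPath x}), (∀ n, x'.1 n = x.1 (n + m)) →
    ∀ n, (φ x').1 n = (φ x).1 (n + m)
  edge_congr : ∀ (x x' : {x // M.IsPath x}) (n : ℤ),
    (∀ j, n - k ≤ j → j ≤ n + k → x.1 j = x'.1 j) → (φ x).1 n = (φ x').1 n
  lab_congr : ∀ (x x' : {x // M.IsPath x}) (n : ℤ),
    (∀ j, n - k ≤ j → j ≤ n + k → M.lab (x.1 j) = M.lab (x'.1 j)) →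
      N.lab ((φ x).1 n) = N.lab ((φ x').1 n)

variable (M N) in
/-- A symbolic conjugacy, described by its action on paths: both the bijection on paths and the one
that it induces on labels are block maps in both directions. -/
structure Coding where
  /-- the bijection between the sets of biinfinite paths -/
  φ : {x // M.IsPath x} ≃ {y // N.IsPath y}
  /-- a common window size for all the block maps involved -/
  k : ℕ
  block : IsBlockMap k φ
  block_symm : IsBlockMap k φ.symm

/-- The inverse coding. -/
def Coding.symm (c : Coding M N) : Coding N M := ⟨c.φ.symm, c.k, c.block_symm, c.block⟩

theorem Coding.lab_eq_iff (c : Coding M N) (x x' : {x // M.IsPath x}) :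
    (∀ n, M.lab (x.1 n) = M.lab (x'.1 n)) ↔
      ∀ n, N.lab ((c.φ x).1 n) = N.lab ((c.φ x').1 n) := by
  constructor
  · exact fun h n => c.block.lab_congr x x' n fun j _ _ => h j
  · intro h n
    have h1 := c.block_symm.lab_congr (c.φ x) (c.φ x') n fun j _ _ => h j
    rwa [Equiv.symm_apply_apply, Equiv.symm_apply_apply] at h1

/-- The window can be enlarged, so that the maps in both directions can share one. -/
theorem exists_isBlockMap [Finite A] [Finite E] [TopologicalSpace A] [DiscreteTopology A]
    [TopologicalSpace B] [DiscreteTopology B] [TopologicalSpace E] [DiscreteTopology E]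
    [TopologicalSpace F] [DiscreteTopology F] [Finite F]
    {φ : M.pathShift.carrier → N.pathShift.carrier}
    {ψ : M.labelShift.carrier → N.labelShift.carrier}
    (hφ : IsConjugacy M.pathShift N.pathShift φ) (hψ : IsConjugacy M.labelShift N.labelShift ψ)
    (h : ∀ x, ψ (M.labelMap x) = N.labelMap (φ x)) :
    ∃ k : ℕ, ∀ k' ≥ k, IsBlockMap (M := M) (N := N) k' φ := by
  obtain ⟨k₁, h₁⟩ := hφ.exists_window
  obtain ⟨k₂, h₂⟩ := hψ.exists_window
  refine ⟨max k₁ k₂, fun k' hk => ⟨fun m => hφ.map_translate m,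
    h₁ k' ((le_max_left _ _).trans hk), fun x x' n hx => ?_⟩⟩
  have hn := h₂ k' ((le_max_right _ _).trans hk) (M.labelMap x) (M.labelMap x') n hx
  exact ((congrArg (fun z => z.1 n) (h x)).symm.trans hn).trans (congrArg (fun z => z.1 n) (h x'))

theorem SymbolicConjugate.nonempty_coding [Finite A] [Finite B] [Finite E]
    [TopologicalSpace A] [DiscreteTopology A]
    [TopologicalSpace B] [DiscreteTopology B] [TopologicalSpace E] [DiscreteTopology E]
    [TopologicalSpace F] [DiscreteTopology F] [Finite F] (h : M.SymbolicConjugate N) :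
    Nonempty (Coding M N) := by
  obtain ⟨φ, ψ, hφ, hψ, h⟩ := h
  obtain ⟨k₁, h₁⟩ := exists_isBlockMap hφ hψ h
  obtain ⟨k₂, h₂⟩ := exists_isBlockMap hφ.symm hψ.symm (fun y => by
    obtain ⟨x, rfl⟩ := hφ.2.1.2 y
    rw [Equiv.symm_apply_eq, Equiv.ofBijective_apply, ← h]
    exact congrArg (fun z => ψ (M.labelMap z))
      (Equiv.ofBijective_symm_apply_apply φ hφ.2.1 x).symm)
  exact ⟨⟨Equiv.ofBijective φ hφ.2.1, max k₁ k₂, h₁ _ (le_max_left _ _), h₂ _ (le_max_right _ _)⟩⟩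

/-! ### Transfer of morphisms between idempotents -/

theorem eq_of_periodic_of_eq_left {α : Type*} {g g' : ℤ → α} {L : ℕ} (hL : 0 < L)
    (hg : Function.Periodic g (L : ℤ)) (hg' : Function.Periodic g' (L : ℤ)) {i : ℤ}
    (h : ∀ n < i, g n = g' n) : g = g' := by
  funext n
  rw [← hg.sub_nat_mul_eq (n - i + 1).natAbs, ← hg'.sub_nat_mul_eq (n - i + 1).natAbs]
  refine h _ ?_
  have h1 : (1 : ℤ) ≤ L := by exact_mod_cast hL
  have h2 : ((n - i + 1).natAbs : ℤ) ≤ (n - i + 1).natAbs * L :=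
    le_mul_of_one_le_right (by positivity) h1
  omega

theorem eq_of_periodic_of_eq_right {α : Type*} {g g' : ℤ → α} {L : ℕ} (hL : 0 < L)
    (hg : Function.Periodic g (L : ℤ)) (hg' : Function.Periodic g' (L : ℤ)) {i : ℤ}
    (h : ∀ n, i ≤ n → g n = g' n) : g = g' := by
  funext n
  rw [← hg.nat_mul (i - n).natAbs n, ← hg'.nat_mul (i - n).natAbs n]
  refine h _ ?_
  have h1 : (1 : ℤ) ≤ L := by exact_mod_cast hL
  have h2 : ((i - n).natAbs : ℤ) ≤ (i - n).natAbs * L :=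
    le_mul_of_one_le_right (by positivity) h1
  omega

section Local

variable {A Q E : Type*} {M : Automaton A Q E} {e f s : M.TransitionSemigroup}

theorem _root_.SymbolicAutomata.IsLocal.mem_iff (hs : IsLocal e f s) {p q : Q} :
    q ∈ s.1 p ↔ ∃ r ∈ e.1 p, q ∈ s.1 r := by
  rw [← TransitionSemigroup.mem_mul, hs.1]

theorem _root_.SymbolicAutomata.IsLocal.mem_fixed (hf : IsIdempotentElem f) (hs : IsLocal e f s)
    {p q : Q} (h : q ∈ s.1 p) : q ∈ f.1 q := by
  rw [← hs.2] at h
  obtain ⟨r, -, hr⟩ := TransitionSemigroup.mem_mul.1 h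
  exact (TransitionSemigroup.mem_ran_idem_iff hf).1 ⟨r, hr⟩

theorem Reads.src_mem_iff {a : ℤ → A} {L : ℕ} (he : Reads e a L) (hM : M.IsDeterministic)
    {x y : ℤ → E} (hx : M.IsPath x) (hy : M.IsPath y) (hxa : ∀ n, M.lab (x n) = a n)
    (hya : ∀ n, M.lab (y n) = a n) : M.src (y 0) ∈ e.1 (M.src (x 0)) ↔ y = x := by
  constructor
  · intro h
    exact he.path_ext hM hy hx hya hxa (Part.mem_unique h (he.src_fixed hM hx hxa))
  · rintro rfl
    exact he.src_fixed hM hx hxa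

/-- The rank of `e` is the number of paths labelled by `a`. -/
theorem Reads.rank_eq {a : ℤ → A} {L : ℕ} (he : Reads e a L) (hM : M.IsDeterministic) :
    e.rank = {x : {x // M.IsPath x} | ∀ n, M.lab (x.1 n) = a n}.ncard := by
  rw [← Set.InjOn.ncard_image (f := fun x : {x // M.IsPath x} => M.src (x.1 0)),
    TransitionSemigroup.rank]
  · congr 1
    ext p
    rw [TransitionSemigroup.mem_ran_idem_iff he.idem]
    constructor
    · intro hp
      obtain ⟨x, hx, hxa, hx0⟩ := he.exists_path hM hp
      exact ⟨⟨x, hx⟩, hxa, hx0⟩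
    · rintro ⟨x, hxa, rfl⟩
      exact he.src_fixed hM x.2 hxa
  · intro x hx y hy h
    exact Subtype.ext (he.path_ext hM x.2 y.2 hx hy h)

end Local

theorem IsPath.src_eq_of_eq_left {A Q E : Type*} {M : Automaton A Q E} {x y : ℤ → E}
    (hx : M.IsPath x) (hy : M.IsPath y) {i : ℤ} (h : ∀ n < i, x n = y n) :
    M.src (x i) = M.src (y i) := by
  have h1 := hx (i - 1)
  have h2 := hy (i - 1)
  rw [sub_add_cancel] at h1 h2
  rw [← h1, ← h2, h _ (by omega)]

variable {A B Q R E F : Type*} {M : Automaton A Q E} {N : Automaton B R F} {c : Coding M N}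

/-- A link between `e` and `f`: two periodic label sequences `a` and `b`, with a common period,
whose words of one period define the idempotents `e` and `f`, and such that the coding exchanges
the paths labelled by `a` and the paths labelled by `b`. -/
structure Link (c : Coding M N) (e : M.TransitionSemigroup) (f : N.TransitionSemigroup) where
  /-- the label sequence read by `e` -/
  a : ℤ → A
  /-- the label sequence read by `f` -/
  b : ℤ → B
  /-- a common period -/
  L : ℕ
  left : Reads e a L
  right : Reads f b L
  lab_iff : ∀ x, (∀ n, M.lab (x.1 n) = a n) ↔ ∀ n, N.lab ((c.φ x).1 n) = b n

namespace Link

variable {e e' e'' : M.TransitionSemigroup} {f f' f'' : N.TransitionSemigroup}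

/-- The link for the inverse coding. -/
def symm (l : Link c e f) : Link c.symm f e where
  a := l.b
  b := l.a
  L := l.L
  left := l.right
  right := l.left
  lab_iff y := by
    have h := l.lab_iff (c.φ.symm y)
    rw [Equiv.apply_symm_apply] at h
    exact h.symm

theorem rank_eq (hM : M.IsDeterministic) (hN : N.IsDeterministic) (l : Link c e f) :
    e.rank = f.rank := by
  rw [l.left.rank_eq hM, l.right.rank_eq hN, ← Set.ncard_image_of_injective _ c.φ.injective]
  congr 1
  ext y
  rw [Equiv.image_eq_preimage_symm]
  simp only [Set.mem_preimage, Set.mem_ofPred_eq, l.lab_iff, Equiv.apply_symm_apply]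

/-- A morphism `s` from `e` to `e'` and a morphism `t` from `f` to `f'` match if the coding carries
the action of `s` on paths labelled by periodic sequences to the action of `t`; a path with a given
periodic label stands for its state at time `0`. -/
def Match (l : Link c e f) (l' : Link c e' f') (s : M.TransitionSemigroup)
    (t : N.TransitionSemigroup) : Prop :=
  ∀ x x' : {x // M.IsPath x}, (∀ n, M.lab (x.1 n) = l.a n) → (∀ n, M.lab (x'.1 n) = l'.a n) →
    (M.src (x'.1 0) ∈ s.1 (M.src (x.1 0)) ↔
      N.src ((c.φ x').1 0) ∈ t.1 (N.src ((c.φ x).1 0)))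

variable {l : Link c e f} {l' : Link c e' f'} {l'' : Link c e'' f''}

theorem Match.symm {s : M.TransitionSemigroup} {t : N.TransitionSemigroup}
    (h : Match l l' s t) : Match l.symm l'.symm t s := by
  intro y y' hy hy'
  have := h (c.φ.symm y) (c.φ.symm y') ((l.symm.lab_iff y).1 hy) ((l'.symm.lab_iff y').1 hy')
  rw [Equiv.apply_symm_apply, Equiv.apply_symm_apply] at this
  exact this.symm

theorem match_idem (hM : M.IsDeterministic) (hN : N.IsDeterministic) (l : Link c e f) :
    Match l l e f := by
  intro x x' hx hx'
  rw [l.left.src_mem_iff hM x.2 x'.2 hx hx', l.right.src_mem_iff hN (c.φ x).2 (c.φ x').2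
    ((l.lab_iff x).1 hx) ((l.lab_iff x').1 hx'), ← Subtype.ext_iff, ← Subtype.ext_iff,
    c.φ.apply_eq_iff_eq]

theorem Match.mul (hM : M.IsDeterministic) (hN : N.IsDeterministic)
    {s s' : M.TransitionSemigroup} {t t' : N.TransitionSemigroup} (hs : IsLocal e e' s)
    (ht : IsLocal f f' t) (h : Match l l' s t) (h' : Match l' l'' s' t') :
    Match l l'' (s * s') (t * t') := by
  intro x x'' hx hx''
  rw [TransitionSemigroup.mem_mul, TransitionSemigroup.mem_mul]
  constructor
  · rintro ⟨r, hr, hr'⟩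
    obtain ⟨x', hx', hxa', rfl⟩ := l'.left.exists_path hM (hs.mem_fixed l'.left.idem hr)
    exact ⟨_, (h x ⟨x', hx'⟩ hx hxa').1 hr, (h' ⟨x', hx'⟩ x'' hxa' hx'').1 hr'⟩
  · rintro ⟨r, hr, hr'⟩
    obtain ⟨y', hy', hyb', rfl⟩ := l'.right.exists_path hN (ht.mem_fixed l'.right.idem hr)
    obtain ⟨x', hx'⟩ := c.φ.surjective ⟨y', hy'⟩
    have hxa' : ∀ n, M.lab (x'.1 n) = l'.a n := (l'.lab_iff x').2 (by rw [hx']; exact hyb')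
    refine ⟨_, (h x x' hx hxa').2 ?_, (h' x' x'' hxa' hx'').2 ?_⟩ <;> rw [hx'] <;> assumption

theorem Match.eq (hN : N.IsDeterministic) {s : M.TransitionSemigroup}
    {t t' : N.TransitionSemigroup} (ht : IsLocal f f' t) (ht' : IsLocal f f' t')
    (h : Match l l' s t) (h' : Match l l' s t') : t = t' := by
  have key {t t' : N.TransitionSemigroup} (ht : IsLocal f f' t) (ht' : IsLocal f f' t')
      (h : Match l l' s t) (h' : Match l l' s t') (p q : R) (hq : q ∈ t.1 p) : q ∈ t'.1 p := by
    obtain ⟨r, hr, hq'⟩ := ht.mem_iff.1 hq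
    refine ht'.mem_iff.2 ⟨r, hr, ?_⟩
    obtain ⟨y, hy, hyb, rfl⟩ := l.right.exists_path hN
      ((isLocal_of_idem l.right.idem).mem_fixed l.right.idem hr)
    obtain ⟨y', hy', hyb', rfl⟩ := l'.right.exists_path hN (ht.mem_fixed l'.right.idem hq)
    have h1 := h.symm ⟨y, hy⟩ ⟨y', hy'⟩ hyb hyb'
    have h2 := h'.symm ⟨y, hy⟩ ⟨y', hy'⟩ hyb hyb'
    exact h2.2 (h1.1 hq')
  exact TransitionSemigroup.ext fun p q => ⟨key ht ht' h h' p q, key ht' ht h' h p q⟩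

theorem Match.mul_eq_idem (hM : M.IsDeterministic) (hN : N.IsDeterministic)
    {a b : M.TransitionSemigroup} {a' b' : N.TransitionSemigroup} (ha : IsLocal e e' a)
    (ha' : IsLocal f f' a') (hb' : IsLocal f' f b') (h : Match l l' a a') (h' : Match l' l b b')
    (hab : a * b = e) : a' * b' = f := by
  have h1 := h.mul hM hN ha ha' h'
  rw [hab] at h1
  exact h1.eq hN (ha'.mul hb') (isLocal_of_idem l.right.idem) (l.match_idem hM hN)

/-- Every nonzero morphism `s` from `e` to `e'` is matched by a morphism from `f` to `f'`. If `u`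
is a word defining `s`, the label sequence `…aau a'a'…` is carried by the coding to a sequence which
is `b` far to the left and `b'` far to the right, and its central part defines the morphism
sought. -/
theorem exists_match (hM : M.IsDeterministic) (hN : N.IsDeterministic) (l : Link c e f)
    (l' : Link c e' f') {s : M.TransitionSemigroup} (hs : IsLocal e e' s) (h0 : s.rank ≠ 0) :
    ∃ t, IsLocal f f' t ∧ Match l l' s t := by
  obtain ⟨u, hu, hus⟩ := s.2
  set m := u.length with hm
  have hmpos : 0 < m := List.length_pos_iff.2 hu
  let α : ℤ → A := fun n =>
    if n < 0 then l.a n else if h : n.toNat < u.length then u[n.toNat] else l'.a (n - m)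
  have hαl (n : ℤ) (hn : n < 0) : α n = l.a n := if_pos hn
  have hαr (n : ℤ) (hn : (m : ℤ) ≤ n) : α n = l'.a (n - m) := by
    rw [show α n = _ from if_neg (by omega), dif_neg (by omega)]
  have hαs : M.act (word α 0 m) = s.1 := by
    rw [← hus]
    congr 1
    refine word_eq α 0 u fun k hk => ?_
    have h1 : (0 + (k : ℤ)).toNat = k := by omega
    rw [show α (0 + k) = _ from if_neg (by omega), dif_pos (by omega)]
    simp only [h1]
  -- a transition of `s` gives a path with label `α`
  have hglue (x x' : {x // M.IsPath x}) (hx : ∀ n, M.lab (x.1 n) = l.a n)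
      (hx' : ∀ n, M.lab (x'.1 n) = l'.a n) (h : M.src (x'.1 0) ∈ s.1 (M.src (x.1 0))) :
      ∃ z : {z // M.IsPath z}, (∀ n, M.lab (z.1 n) = α n) ∧ (∀ n < 0, z.1 n = x.1 n) ∧
        ∀ n, (m : ℤ) ≤ n → z.1 n = x'.1 (n - m) := by
    obtain ⟨z, hz, h1, h2, h3⟩ := x.2.exists_glue hM (y := fun n => x'.1 (n - m)) (a := α)
      (i := 0) (m := m) (fun n => by rw [x'.2, sub_add_eq_add_sub])
      (fun n hn => by rw [hx, hαl n hn])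
      (fun n hn => by rw [hx', hαr n (by omega)]) (by
        rw [hαs, zero_add, sub_self]
        exact h)
    exact ⟨⟨z, hz⟩, h1, h2, fun n hn => h3 n (by omega)⟩
  -- the coding has window `[-k, k]`, so it preserves agreement far to the left and to the right
  have hleft {x x' : {x // M.IsPath x}} (h : ∀ n < 0, x.1 n = x'.1 n) (n : ℤ) (hn : n < -c.k) :
      (c.φ x).1 n = (c.φ x').1 n :=
    c.block.edge_congr x x' n fun j _ hj => h j (by omega)
  have hright {x x' : {x // M.IsPath x}} (h : ∀ n, (m : ℤ) ≤ n → x.1 n = x'.1 (n - m)) (n : ℤ)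
      (hn : m + c.k ≤ n) : (c.φ x).1 n = (c.φ x').1 (n - m) := by
    let w : {x // M.IsPath x} := ⟨fun n => x'.1 (n - m), fun n => by
      rw [x'.2, sub_add_eq_add_sub]⟩
    rw [c.block.edge_congr x w n fun j hj _ => h j (by omega),
      c.block.map_translate (-m) x' w (fun _ => rfl), sub_eq_add_neg]
  -- since `s` is nonzero, `α` is the label of some path `z₀`, and the coding can be applied to it
  obtain ⟨z₀, hz₀, b₁, b₂⟩ : ∃ z₀ : {z // M.IsPath z}, (∀ n, M.lab (z₀.1 n) = α n) ∧
      (∀ n < -(c.k : ℤ), N.lab ((c.φ z₀).1 n) = l.b n) ∧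
      ∀ n, (m : ℤ) + c.k ≤ n → N.lab ((c.φ z₀).1 n) = l'.b (n - m) := by
    obtain ⟨p, q, hq⟩ : ∃ p q, q ∈ s.1 p := by
      by_contra! h
      refine h0 ?_
      rw [TransitionSemigroup.rank, Set.eq_empty_of_forall_notMem (s := s.1.ran)
        (fun q ⟨p, hq⟩ => h p q hq), Set.ncard_empty]
    obtain ⟨r, hr, hq'⟩ := hs.mem_iff.1 hq
    obtain ⟨x, hx, hxa, rfl⟩ := l.left.exists_path hM
      ((isLocal_of_idem l.left.idem).mem_fixed l.left.idem hr)
    obtain ⟨x', hx', hxa', rfl⟩ := l'.left.exists_path hM (hs.mem_fixed l'.left.idem hq)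
    obtain ⟨z, hz, h1, h2⟩ := hglue ⟨x, hx⟩ ⟨x', hx'⟩ hxa hxa' hq'
    refine ⟨z, hz, fun n hn => ?_, fun n hn => ?_⟩
    · rw [hleft h1 n hn]
      exact (l.lab_iff ⟨x, hx⟩).1 hxa n
    · rw [hright h2 n hn]
      exact (l'.lab_iff ⟨x', hx'⟩).1 hxa' _
  let β : ℤ → B := fun n => N.lab ((c.φ z₀).1 n)
  have hαβ (z : {z // M.IsPath z}) : (∀ n, M.lab (z.1 n) = α n) ↔
      ∀ n, N.lab ((c.φ z).1 n) = β n := by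
    rw [← c.lab_eq_iff]
    simp only [hz₀]
  -- the central part of `β` is the window from `-K` to `m + K'`; it extends beyond the
  -- reach of the coding, and to the right by one more period so that it ends with the word of `f'`
  have hK : c.k ≤ c.k * l.L := Nat.le_mul_of_pos_right _ l.left.pos
  have hK' : c.k + 1 ≤ (c.k + 1) * l'.L := Nat.le_mul_of_pos_right _ l'.left.pos
  set K := c.k * l.L with hKdef
  set K' := (c.k + 1) * l'.L with hKdef'
  have hw : -(K : ℤ) + (K + m + K' : ℕ) = m + K' := by push_cast; ring
  let t₀ : N.TransitionSemigroup :=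
    ⟨N.act (word β (-K) (K + m + K')), _, word_ne_nil _ _ (by omega), rfl⟩
  have ht₀ : t₀ * f' = t₀ := by
    have h1 : N.act (word β (-K + (K + m + c.k * l'.L : ℕ)) l'.L) = f'.1 := by
      rw [← l'.right.act_word c.k]
      congr 1
      refine word_congr fun j _ => ?_
      have h2 : -(K : ℤ) + (K + m + c.k * l'.L : ℕ) + j = c.k * l'.L + j + m := by
        push_cast
        ring
      have h3 : (c.k : ℤ) ≤ c.k * l'.L := by exact_mod_cast Nat.le_mul_of_pos_right _ l'.left.pos
      rw [h2]
      refine (b₂ _ (by omega)).trans ?_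
      rw [add_sub_cancel_right]
    have h2 : t₀.1 = f'.1.comp (N.act (word β (-K) (K + m + c.k * l'.L))) := by
      rw [← h1, ← act_append, ← word_add]
      change N.act _ = _
      rw [hKdef', add_one_mul, ← add_assoc]
    have h3 : f'.1.comp f'.1 = f'.1 := congrArg Subtype.val l'.right.idem.eq
    refine Subtype.ext ?_
    change f'.1.comp t₀.1 = t₀.1
    rw [h2, ← PFun.comp_assoc, h3]
  have hsrcl (x : {x // M.IsPath x}) (hx : ∀ n, M.lab (x.1 n) = l.a n) :
      (c.φ x).1 (-(K : ℤ)) = (c.φ x).1 0 := by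
    have hp := l.right.path_periodic hN (c.φ x).2 ((l.lab_iff x).1 hx)
    rw [← hp.nat_mul c.k (-(K : ℤ)), hKdef]
    simp
  have hsrcr (x : {x // M.IsPath x}) (hx : ∀ n, M.lab (x.1 n) = l'.a n) :
      (c.φ x).1 (K' : ℤ) = (c.φ x).1 0 := by
    have hp := l'.right.path_periodic hN (c.φ x).2 ((l'.lab_iff x).1 hx)
    rw [← hp.nat_mul (c.k + 1) 0, hKdef']
    simp
  have hmatch : Match l l' s t₀ := by
    intro x x' hx hx'
    constructor
    · intro h
      obtain ⟨z, hz, h1, h2⟩ := hglue x x' hx hx' h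
      have hact := (c.φ z).2.mem_act_of_lab hN (a := β) (i := -K) (n := K + m + K')
        fun k _ => (hαβ z).1 hz _
      rw [hw, hright h2 (m + K') (by omega), add_sub_cancel_left, hsrcr x' hx',
        (c.φ z).2.src_eq_of_eq_left (c.φ x).2 (fun n hn => hleft h1 n (by omega)),
        hsrcl x hx] at hact
      exact hact
    · intro h
      obtain ⟨y, hy, hyβ, hy1, hy2⟩ := (c.φ x).2.exists_glue hN
        (y := fun n => (c.φ x').1 (n - m)) (a := β) (i := -K) (m := K + m + K')
        (fun n => by rw [(c.φ x').2, sub_add_eq_add_sub])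
        (fun n hn => ((l.lab_iff x).1 hx n).trans (b₁ n (by omega)).symm)
        (fun n hn => ((l'.lab_iff x').1 hx' _).trans (b₂ n (by omega)).symm) (by
          rw [hw, add_sub_cancel_left, hsrcr x' hx', hsrcl x hx]
          exact h)
      obtain ⟨z, hzy⟩ := c.φ.surjective ⟨y, hy⟩
      have hz : ∀ n, M.lab (z.1 n) = α n := (hαβ z).2 (by rw [hzy]; exact hyβ)
      have hzy' : (c.φ z).1 = y := by rw [hzy]
      have hact := z.2.mem_act_of_lab hM (a := α) (i := 0) (n := m) fun k _ => hz _
      rw [hαs, zero_add] at hact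
      -- the two ends of `z` are those of `x` and `x'`
      obtain ⟨w, hwp, hwa, hzw, hzw0⟩ := l.left.exists_left hM z.2 (fun n hn => by
        rw [hz, hαl n hn])
      obtain ⟨w', hwp', hwa', hzw', hzw0'⟩ := l'.left.exists_right hM z.2 (fun n hn => by
        rw [hz, hαr n hn]) (hs.mem_fixed l'.left.idem hact)
      have hwx : c.φ ⟨w, hwp⟩ = c.φ x := by
        refine Subtype.ext (eq_of_periodic_of_eq_left l.left.pos (i := -K)
          (l.right.path_periodic hN (c.φ _).2 ((l.lab_iff ⟨w, hwp⟩).1 hwa))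
          (l.right.path_periodic hN (c.φ x).2 ((l.lab_iff x).1 hx)) fun n hn => ?_)
        rw [← hleft (x := z) hzw n (by omega), hzy', hy1 n hn]
      have hwx' : c.φ ⟨w', hwp'⟩ = c.φ x' := by
        refine Subtype.ext (eq_of_periodic_of_eq_right l'.left.pos (i := K')
          (l'.right.path_periodic hN (c.φ _).2 ((l'.lab_iff ⟨w', hwp'⟩).1 hwa'))
          (l'.right.path_periodic hN (c.φ x').2 ((l'.lab_iff x').1 hx')) fun n hn => ?_)
        have h1 := hright (x := z) (x' := ⟨w', hwp'⟩) hzw' (n + m) (by omega)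
        rw [hzy', hy2 _ (by omega), add_sub_cancel_right] at h1
        exact h1.symm
      rw [← c.φ.injective hwx, ← c.φ.injective hwx', ← hzw0, ← hzw0']
      exact hact
  refine ⟨f * t₀, ⟨by rw [← mul_assoc, l.right.idem.eq], by rw [mul_assoc, ht₀]⟩,
    fun x x' hx hx' => ?_⟩
  have hfx := l.right.src_fixed hN (c.φ x).2 ((l.lab_iff x).1 hx)
  rw [hmatch x x' hx hx', TransitionSemigroup.mem_mul]
  constructor
  · exact fun h => ⟨_, hfx, h⟩
  · rintro ⟨r, hr, hr'⟩
    rwa [Part.mem_unique hr hfx] at hr'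

end Link
/-! ### Linking nonzero idempotents -/

section ExistsLink

variable {A B Q R E F : Type*} {M : Automaton A Q E} {N : Automaton B R F}

instance [Finite Q] : Finite M.TransitionSemigroup :=
  Finite.of_injective (fun s => {x : Q × Q | x.2 ∈ s.1 x.1}) fun _ _ h =>
    TransitionSemigroup.ext fun p q => Set.ext_iff.1 h (p, q)

theorem exists_periodic_word {w : List A} (hw : w ≠ []) :
    ∃ a : ℤ → A, Function.Periodic a (w.length : ℤ) ∧ word a 0 w.length = w := by
  have hpos : (0 : ℤ) < w.length := by exact_mod_cast List.length_pos_iff.2 hw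
  refine ⟨fun n => w[(n % w.length).toNat]'(by
    have := Int.emod_lt_of_pos n hpos
    omega), fun n => ?_, word_eq _ _ _ fun k hk => ?_⟩
  · simp only [Int.add_emod_right]
  · have h : ((0 + (k : ℤ)) % w.length).toNat = k := by
      rw [zero_add, Int.emod_eq_of_lt (by omega) (by omega), Int.toNat_natCast]
    simp only [h]

theorem Reads.mul {e : M.TransitionSemigroup} {a : ℤ → A} {L : ℕ} (he : Reads e a L) {n : ℕ}
    (hn : 0 < n) : Reads e a (n * L) := by
  refine ⟨he.idem, Nat.mul_pos hn he.pos, by push_cast; exact he.periodic.nat_mul n, ?_⟩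
  induction n, hn using Nat.le_induction with
  | base =>
    rw [Nat.succ_eq_add_one, zero_add, one_mul]
    exact he.act_eq
  | succ n hn ih =>
    have h := he.act_word n
    rw [add_one_mul, word_add, act_append, ih, zero_add, Nat.cast_mul, h]
    exact congrArg Subtype.val he.idem.eq

/-- Every periodic label sequence is read by an idempotent, with a multiple of its period. -/
theorem exists_reads [Finite Q] {a : ℤ → A} {L : ℕ} (hL : 0 < L)
    (ha : Function.Periodic a (L : ℤ)) :
    ∃ (e : M.TransitionSemigroup) (n : ℕ), 0 < n ∧ Reads e a (n * L) := by
  let _ : TopologicalSpace M.TransitionSemigroup := ⊥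
  have : DiscreteTopology M.TransitionSemigroup := ⟨rfl⟩
  obtain ⟨e, ⟨n, hn, hne⟩, he⟩ := exists_idempotent_in_compact_subsemigroup
    (fun _ : M.TransitionSemigroup => continuous_of_discreteTopology)
    {s | ∃ n : ℕ, 0 < n ∧ M.act (word a 0 (n * L)) = s.1}
    ⟨⟨M.act (word a 0 (1 * L)), _, word_ne_nil _ _ (by omega), rfl⟩, 1, one_pos, rfl⟩
    (Set.toFinite _).isCompact (by
      rintro s ⟨n, hn, hs⟩ t ⟨m, -, ht⟩
      refine ⟨n + m, by omega, ?_⟩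
      rw [add_mul, word_add, act_append, hs]
      have : word a (0 + (n * L : ℕ)) (m * L) = word a 0 (m * L) := by
        refine word_congr fun k _ => ?_
        rw [zero_add, add_comm, Nat.cast_mul, ha.nat_mul, zero_add]
      rw [this, ht]
      rfl)
  exact ⟨e, n, hn, he, Nat.mul_pos hn hL, by push_cast; exact ha.nat_mul n, hne⟩

/-- Every nonzero idempotent is linked to an idempotent: the coding carries the periodic sequence
read by `e` to a periodic sequence with the same period. -/
theorem exists_link [Finite R] (hM : M.IsDeterministic) (c : Coding M N)
    {e : M.TransitionSemigroup} (he : IsIdempotentElem e) (h0 : e.rank ≠ 0) :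
    ∃ f, Nonempty (Link c e f) := by
  obtain ⟨w, hw, hwe⟩ := e.2
  obtain ⟨a, ha, haw⟩ := exists_periodic_word hw
  have hL : 0 < w.length := List.length_pos_iff.2 hw
  have hr : Reads e a w.length := ⟨he, hL, ha, by rw [haw, hwe]⟩
  obtain ⟨p, hp⟩ := Set.nonempty_of_ncard_ne_zero h0
  obtain ⟨x, hx, hxa, -⟩ := hr.exists_path hM ((TransitionSemigroup.mem_ran_idem_iff he).1 hp)
  have hb : Function.Periodic (fun n => N.lab ((c.φ ⟨x, hx⟩).1 n)) (w.length : ℤ) := by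
    intro n
    have h := c.block.map_translate w.length ⟨x, hx⟩ ⟨x, hx⟩
      (fun n => (hr.path_periodic hM hx hxa n).symm) n
    exact congrArg N.lab h.symm
  obtain ⟨f, n, hn, hf⟩ := exists_reads (M := N) hL hb
  refine ⟨f, ⟨_, _, _, hr.mul hn, hf, fun x' => ?_⟩⟩
  rw [← c.lab_eq_iff]
  simp only [hxa]

end ExistsLink

/-! ### Invariance of Green's relations under links -/

section Invariance

variable {A B Q R E F : Type*} {M : Automaton A Q E} {N : Automaton B R F}
  {c : Coding M N} {e e' : M.TransitionSemigroup} {f f' : N.TransitionSemigroup}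

theorem Link.jle [Finite Q] (hM : M.IsDeterministic) (hN : N.IsDeterministic) (l : Link c e f)
    (l' : Link c e' f') (h0 : e.rank ≠ 0) (h : JLE e e') : JLE f f' := by
  obtain ⟨a, b, ha, hb, hab⟩ := (jle_idem_iff l.left.idem l'.left.idem).1 h
  obtain ⟨ha0, hb0⟩ := TransitionSemigroup.rank_ne_zero_of_mul (hab.symm ▸ h0)
  obtain ⟨a', ha', haa'⟩ := l.exists_match hM hN l' ha ha0
  obtain ⟨b', hb', hbb'⟩ := l'.exists_match hM hN l hb hb0
  exact (jle_idem_iff l.right.idem l'.right.idem).2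
    ⟨a', b', ha', hb', haa'.mul_eq_idem hM hN ha ha' hb' hbb' hab⟩

theorem Link.greenD [Finite Q] (hM : M.IsDeterministic) (hN : N.IsDeterministic) (l : Link c e f)
    (l' : Link c e' f') (h0 : e.rank ≠ 0) (h : GreenD e e') : GreenD f f' := by
  obtain ⟨a, b, ha, hb, hab, hba⟩ := (greenD_idem_iff l.left.idem l'.left.idem).1 h
  obtain ⟨ha0, hb0⟩ := TransitionSemigroup.rank_ne_zero_of_mul (hab.symm ▸ h0)
  obtain ⟨a', ha', haa'⟩ := l.exists_match hM hN l' ha ha0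
  obtain ⟨b', hb', hbb'⟩ := l'.exists_match hM hN l hb hb0
  exact (greenD_idem_iff l.right.idem l'.right.idem).2
    ⟨a', b', ha', hb', haa'.mul_eq_idem hM hN ha ha' hb' hbb' hab,
      hbb'.mul_eq_idem hM hN hb hb' ha' haa' hba⟩

theorem rank_hClass [Finite Q] {e : {e : M.TransitionSemigroup // IsIdempotentElem e}}
    (s : HClass e) :
    s.1.rank = e.1.rank :=
  TransitionSemigroup.rank_eq_of_greenD ⟨e.1, s.2.2, rfl⟩

theorem Link.nonempty_mulEquiv [Finite Q] [Finite R] (hM : M.IsDeterministic)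
    (hN : N.IsDeterministic) (l : Link c e f)
    (h0 : e.rank ≠ 0) :
    Nonempty (HClass ⟨e, l.left.idem⟩ ≃* HClass ⟨f, l.right.idem⟩) := by
  refine HClass.nonempty_mulEquiv_of_rel _ _ (Match l l) (l.match_idem hM hN) ?_ ?_ ?_ ?_ ?_
  · exact fun s t s' t' hs ht _ _ h h' => h.mul hM hN hs ht h'
  · exact fun s => l.exists_match hM hN l s.isLocal ((rank_hClass s).trans_ne h0)
  · intro t
    have hf0 : f.rank ≠ 0 := (l.rank_eq hM hN).symm.trans_ne h0
    obtain ⟨s, hs, hts⟩ := l.symm.exists_match hN hM l.symm t.isLocal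
      ((rank_hClass t).trans_ne hf0)
    exact ⟨s, hs, hts.symm⟩
  · exact fun s t t' ht ht' h h' => h.eq hN ht ht' h'
  · exact fun s s' t hs hs' h h' => h.symm.eq hM hs hs' h'.symm

end Invariance

/-! ### The correspondence between vertices of the syntactic graphs -/

section Graph

variable {A B Q R E F : Type*} {M : Automaton A Q E} {N : Automaton B R F}

/-- A correspondence between `U` and `V` that is unique in both directions and compatible with
edges and labels is the graph of an isomorphism. -/
theorem isomorphicOn_of_rel {U : Set M.Vertex} {V : Set N.Vertex}
    (r : M.Vertex → N.Vertex → Prop) (hex : ∀ C ∈ U, ∃ D ∈ V, r C D)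
    (hex' : ∀ D ∈ V, ∃ C ∈ U, r C D) (huniq : ∀ C D D', r C D → r C D' → D = D')
    (huniq' : ∀ C C' D, r C D → r C' D → C = C')
    (hedge : ∀ C D C' D', r C D → r C' D' → (C.Edge C' ↔ D.Edge D'))
    (hlab : ∀ C D, r C D → C.SameLabels D) : IsomorphicOn U V := by
  choose φ hφV hφ using hex
  refine ⟨Equiv.ofBijective (fun C : U => (⟨φ C.1 C.2, hφV C.1 C.2⟩ : V)) ⟨fun C C' h => ?_,
    fun D => ?_⟩, fun C C' => hedge _ _ _ _ (hφ C.1 C.2) (hφ C'.1 C'.2),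
    fun C => hlab _ _ (hφ C.1 C.2)⟩
  · have h' : φ C.1 C.2 = φ C'.1 C'.2 := congrArg Subtype.val h
    exact Subtype.ext (huniq' _ _ _ (hφ C.1 C.2) (h' ▸ hφ C'.1 C'.2))
  · obtain ⟨C, hC, hCD⟩ := hex' D.1 D.2
    exact ⟨⟨C, hC⟩, Subtype.ext (huniq _ _ _ (hφ C hC) hCD)⟩

/-- The `𝓓`-classes `C` and `D` contain linked nonzero idempotents. -/
def Corr (c : Coding M N) (C : M.Vertex) (D : N.Vertex) : Prop :=
  ∃ e ∈ C.1, ∃ f ∈ D.1, e.rank ≠ 0 ∧ Nonempty (Link c e f)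

variable {c : Coding M N}

theorem Corr.symm (hM : M.IsDeterministic) (hN : N.IsDeterministic) {C : M.Vertex} {D : N.Vertex}
    (h : Corr c C D) : Corr c.symm D C := by
  obtain ⟨e, he, f, hf, h0, ⟨l⟩⟩ := h
  exact ⟨f, hf, e, he, (l.rank_eq hM hN).symm.trans_ne h0, ⟨l.symm⟩⟩

theorem Vertex.edge_iff {C D : M.Vertex} {s t : M.TransitionSemigroup} (hs : s ∈ C.1)
    (ht : t ∈ D.1) : C.Edge D ↔ JLE t s := by
  constructor
  · rintro ⟨t', ht', s', hs', h⟩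
    exact (D.2.greenD ht ht').jle.trans (h.trans (C.2.greenD hs' hs).jle)
  · exact fun h => ⟨t, ht, s, hs, h⟩

theorem Vertex.rank_eq [Finite Q] (C : M.Vertex) {s t : M.TransitionSemigroup} (hs : s ∈ C.1)
    (ht : t ∈ C.1) :
    s.rank = t.rank :=
  TransitionSemigroup.rank_eq_of_greenD (C.2.greenD hs ht)

theorem mem_nonNullVertices_iff [Finite Q] {C : M.Vertex} {s : M.TransitionSemigroup}
    (hs : s ∈ C.1) :
    C ∈ M.nonNullVertices ↔ s.rank ≠ 0 :=
  ⟨fun h => h s hs, fun h _ ht => (C.rank_eq ht hs).trans_ne h⟩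

theorem Corr.left_mem [Finite Q] {C : M.Vertex} {D : N.Vertex} (h : Corr c C D) :
    C ∈ M.nonNullVertices := by
  obtain ⟨e, he, f, hf, h0, ⟨l⟩⟩ := h
  exact (mem_nonNullVertices_iff he).2 h0

/-- Every nonnull vertex contains a nonzero idempotent, which can be linked. -/
theorem exists_corr [Finite R] (hM : M.IsDeterministic) (c : Coding M N) {C : M.Vertex}
    (hC : C ∈ M.nonNullVertices) : ∃ D, Corr c C D := by
  obtain ⟨-, e, heC, he⟩ := C.2
  obtain ⟨f, ⟨l⟩⟩ := exists_link hM c he (hC e heC)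
  exact ⟨⟨_, isRegularDClass_of_idem l.right.idem⟩, e, heC, f, GreenD.refl f, hC e heC, ⟨l⟩⟩

theorem Corr.right_unique [Finite Q] [Finite R] (hM : M.IsDeterministic) (hN : N.IsDeterministic)
    {C : M.Vertex}
    {D D' : N.Vertex} (h : Corr c C D) (h' : Corr c C D') : D = D' := by
  obtain ⟨e, he, f, hf, h0, ⟨l⟩⟩ := h
  obtain ⟨e', he', f', hf', -, ⟨l'⟩⟩ := h'
  exact Subtype.ext (D.2.eq D'.2 hf hf' (l.greenD hM hN l' h0 (C.2.greenD he he')))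

theorem Corr.edge [Finite Q] [Finite R] (hM : M.IsDeterministic) (hN : N.IsDeterministic)
    {C C' : M.Vertex}
    {D D' : N.Vertex} (h : Corr c C D) (h' : Corr c C' D') (hE : C.Edge C') : D.Edge D' := by
  obtain ⟨e, he, f, hf, -, ⟨l⟩⟩ := h
  obtain ⟨e', he', f', hf', h0, ⟨l'⟩⟩ := h'
  exact (Vertex.edge_iff hf hf').2 (l'.jle hM hN l h0 ((Vertex.edge_iff he he').1 hE))

theorem Corr.sameLabels [Finite Q] [Finite R] (hM : M.IsDeterministic) (hN : N.IsDeterministic)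
    {C : M.Vertex}
    {D : N.Vertex} (h : Corr c C D) : C.SameLabels D := by
  obtain ⟨e, he, f, hf, h0, ⟨l⟩⟩ := h
  refine ⟨fun s hs t ht => ?_, fun e' f' he' hf' => ?_⟩
  · rw [C.rank_eq hs he, D.rank_eq ht hf, l.rank_eq hM hN]
  · obtain ⟨g₁⟩ := GreenD.nonempty_mulEquiv (f := ⟨e, l.left.idem⟩) (C.2.greenD he' he)
    obtain ⟨g₂⟩ := l.nonempty_mulEquiv hM hN h0
    obtain ⟨g₃⟩ := GreenD.nonempty_mulEquiv (e := ⟨f, l.right.idem⟩) (D.2.greenD hf hf')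
    exact ⟨(g₁.trans g₂).trans g₃⟩

/-! ### The vertex of rank zero -/

theorem jle_of_rank_eq_zero [Finite Q] {s : M.TransitionSemigroup} (hs : s.rank = 0)
    (t : M.TransitionSemigroup) : JLE s t := by
  refine jle_iff.2 ⟨s, 1, ?_⟩
  rw [mul_one, ← WithOne.coe_mul, WithOne.coe_inj]
  refine TransitionSemigroup.eq_of_rank_eq_zero (Nat.le_zero.1 ?_) hs
  exact hs ▸ TransitionSemigroup.rank_mul_le_left s t

theorem hasZero_iff [Finite Q] : M.HasZero ↔ ∃ C : M.Vertex, C ∉ M.nonNullVertices := by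
  constructor
  · rintro ⟨s, hs⟩
    have hidem : IsIdempotentElem s := TransitionSemigroup.eq_of_rank_eq_zero
      (Nat.le_zero.1 (hs ▸ TransitionSemigroup.rank_mul_le_left s s)) hs
    refine ⟨⟨_, isRegularDClass_of_idem hidem⟩, fun h => h s (GreenD.refl s) hs⟩
  · intro ⟨C, hC⟩
    simp only [nonNullVertices, Set.mem_ofPred_eq, not_forall, not_not] at hC
    obtain ⟨s, -, hs⟩ := hC
    exact ⟨s, hs⟩

theorem Vertex.rank_eq_zero [Finite Q] {C : M.Vertex} (hC : C ∉ M.nonNullVertices)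
    {s : M.TransitionSemigroup} (hs : s ∈ C.1) : s.rank = 0 := by
  rw [mem_nonNullVertices_iff hs] at hC
  exact not_not.1 hC

theorem Vertex.eq_of_null [Finite Q] {C C' : M.Vertex} (hC : C ∉ M.nonNullVertices)
    (hC' : C' ∉ M.nonNullVertices) : C = C' := by
  obtain ⟨-, e, he, -⟩ := C.2
  obtain ⟨-, e', he', -⟩ := C'.2
  refine Subtype.ext (C.2.eq C'.2 he he' ?_)
  rw [TransitionSemigroup.eq_of_rank_eq_zero (rank_eq_zero hC he) (rank_eq_zero hC' he')]
  exact GreenD.refl _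

theorem Vertex.edge_of_null [Finite Q] (C : M.Vertex) {C' : M.Vertex}
    (hC' : C' ∉ M.nonNullVertices) :
    C.Edge C' := by
  obtain ⟨-, e, he, -⟩ := C.2
  obtain ⟨-, e', he', -⟩ := C'.2
  exact (edge_iff he he').2 (jle_of_rank_eq_zero (rank_eq_zero hC' he') e)

theorem Vertex.not_edge_of_null [Finite Q] {C C' : M.Vertex} (hC : C ∉ M.nonNullVertices)
    (hC' : C' ∈ M.nonNullVertices) : ¬ C.Edge C' := by
  obtain ⟨-, e, he, -⟩ := C.2
  obtain ⟨-, e', he', -⟩ := C'.2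
  intro h
  have hle := TransitionSemigroup.rank_le_of_jle ((edge_iff he he').1 h)
  rw [rank_eq_zero hC he] at hle
  exact hC' e' he' (Nat.le_zero.1 hle)

theorem subsingleton_hClass [Finite Q] {e : {e : M.TransitionSemigroup // IsIdempotentElem e}}
    (he : e.1.rank = 0) : Subsingleton (HClass e) :=
  ⟨fun s t => Subtype.ext (TransitionSemigroup.eq_of_rank_eq_zero ((rank_hClass s).trans he)
    ((rank_hClass t).trans he))⟩

theorem Vertex.sameLabels_of_null [Finite Q] [Finite R] {C : M.Vertex} {D : N.Vertex}
    (hC : C ∉ M.nonNullVertices)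
    (hD : D ∉ N.nonNullVertices) : C.SameLabels D := by
  refine ⟨fun s hs t ht => ?_, fun e f he hf => ?_⟩
  · rw [rank_eq_zero hC hs, rank_eq_zero hD ht]
  · have := subsingleton_hClass (rank_eq_zero hC he)
    have := subsingleton_hClass (rank_eq_zero hD hf)
    let _ : Unique (HClass e) := uniqueOfSubsingleton 1
    let _ : Unique (HClass f) := uniqueOfSubsingleton 1
    exact ⟨MulEquiv.ofUnique⟩

theorem HasZero.of_isomorphic [Finite Q] (h : M.SyntacticGraphsIsomorphic N) (h0 : M.HasZero) :
    N.HasZero := by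
  obtain ⟨φ, -, hlab⟩ := h
  obtain ⟨C, hC⟩ := hasZero_iff.1 h0
  obtain ⟨-, e, he, -⟩ := C.2
  obtain ⟨-, f, hf, -⟩ := (φ ⟨C, trivial⟩).1.2
  exact ⟨f, by rw [← (hlab ⟨C, trivial⟩).1 e he f hf, Vertex.rank_eq_zero hC he]⟩

theorem HasZero.of_isomorphic_symm [Finite R] (h : M.SyntacticGraphsIsomorphic N) (h0 : N.HasZero) :
    M.HasZero := by
  obtain ⟨φ, -, hlab⟩ := h
  obtain ⟨D, hD⟩ := hasZero_iff.1 h0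
  obtain ⟨C, hCD⟩ := φ.surjective ⟨D, trivial⟩
  obtain ⟨-, e, he, -⟩ := C.1.2
  obtain ⟨-, f, hf, -⟩ := D.2
  have hlabC := hlab C
  rw [hCD] at hlabC
  exact ⟨e, by rw [hlabC.1 e he f hf, Vertex.rank_eq_zero hD hf]⟩

end Graph

section Isomorphism

variable {A B Q R E F : Type*} [Finite Q] [Finite R] {M : Automaton A Q E} {N : Automaton B R F}

theorem Coding.nonNullSyntacticGraphsIsomorphic (hM : M.IsDeterministic) (hN : N.IsDeterministic)
    (c : Coding M N) : M.NonNullSyntacticGraphsIsomorphic N := by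
  refine isomorphicOn_of_rel (Corr c) (fun C hC => ?_) (fun D hD => ?_)
    (fun C D D' h h' => h.right_unique hM hN h')
    (fun C C' D h h' => (h.symm hM hN).right_unique hN hM (h'.symm hM hN))
    (fun C D C' D' h h' => ⟨h.edge hM hN h', (h.symm hM hN).edge hN hM (h'.symm hM hN)⟩)
    (fun C D h => h.sameLabels hM hN)
  · obtain ⟨D, h⟩ := exists_corr hM c hC
    exact ⟨D, (h.symm hM hN).left_mem, h⟩
  · obtain ⟨C, h⟩ := exists_corr hN c.symm hD
    exact ⟨C, (h.symm hN hM).left_mem, h.symm hN hM⟩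

/-- When both semigroups contain the empty map or neither does, the correspondence extends to the
vertices of rank zero, which lie below all the other vertices and have a trivial group. -/
theorem Coding.syntacticGraphsIsomorphic (hM : M.IsDeterministic) (hN : N.IsDeterministic)
    (c : Coding M N) (h0 : M.HasZero ↔ N.HasZero) : M.SyntacticGraphsIsomorphic N := by
  have hl {C : M.Vertex} {D : N.Vertex} (h : Corr c C D) : C ∈ M.nonNullVertices := h.left_mem
  have hr {C : M.Vertex} {D : N.Vertex} (h : Corr c C D) : D ∈ N.nonNullVertices :=
    (h.symm hM hN).left_mem
  refine isomorphicOn_of_rel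
    (fun C D => Corr c C D ∨ C ∉ M.nonNullVertices ∧ D ∉ N.nonNullVertices) ?_ ?_ ?_ ?_ ?_ ?_
  · intro C _
    by_cases hC : C ∈ M.nonNullVertices
    · obtain ⟨D, h⟩ := exists_corr hM c hC
      exact ⟨D, trivial, Or.inl h⟩
    · obtain ⟨D, hD⟩ := hasZero_iff.1 (h0.1 (hasZero_iff.2 ⟨C, hC⟩))
      exact ⟨D, trivial, Or.inr ⟨hC, hD⟩⟩
  · intro D _
    by_cases hD : D ∈ N.nonNullVertices
    · obtain ⟨C, h⟩ := exists_corr hN c.symm hD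
      exact ⟨C, trivial, Or.inl (h.symm hN hM)⟩
    · obtain ⟨C, hC⟩ := hasZero_iff.1 (h0.2 (hasZero_iff.2 ⟨D, hD⟩))
      exact ⟨C, trivial, Or.inr ⟨hC, hD⟩⟩
  · rintro C D D' (h | h) (h' | h')
    · exact h.right_unique hM hN h'
    · exact absurd (hl h) h'.1
    · exact absurd (hl h') h.1
    · exact Vertex.eq_of_null h.2 h'.2
  · rintro C C' D (h | h) (h' | h')
    · exact (h.symm hM hN).right_unique hN hM (h'.symm hM hN)
    · exact absurd (hr h) h'.2
    · exact absurd (hr h') h.2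
    · exact Vertex.eq_of_null h.1 h'.1
  · rintro C D C' D' h (h' | h')
    · rcases h with h | h
      · exact ⟨h.edge hM hN h', (h.symm hM hN).edge hN hM (h'.symm hM hN)⟩
      · exact iff_of_false (Vertex.not_edge_of_null h.1 (hl h'))
          (Vertex.not_edge_of_null h.2 (hr h'))
    · exact iff_of_true (C.edge_of_null h'.1) (D.edge_of_null h'.2)
  · rintro C D (h | h)
    · exact h.sameLabels hM hN
    · exact Vertex.sameLabels_of_null h.1 h.2

end Isomorphism

end Automaton
end SymbolicAutomata

theorem mainTheorem2 {A B Q R E F : Type*} [Finite A] [Finite B] [Finite Q] [Finite R]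
    [Finite E] [Finite F]
    [TopologicalSpace A] [DiscreteTopology A] [TopologicalSpace B] [DiscreteTopology B]
    [TopologicalSpace E] [DiscreteTopology E] [TopologicalSpace F] [DiscreteTopology F]
    (M : SymbolicAutomata.Automaton A Q E) (N : SymbolicAutomata.Automaton B R F)
    (hM : M.IsDeterministic) (hN : N.IsDeterministic) (h : M.SymbolicConjugate N) :
    M.NonNullSyntacticGraphsIsomorphic N ∧
      (M.SyntacticGraphsIsomorphic N ↔ (M.HasZero ↔ N.HasZero)) := by
  obtain ⟨c⟩ := h.nonempty_coding
  exact ⟨c.nonNullSyntacticGraphsIsomorphic hM hN,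
    fun h => ⟨SymbolicAutomata.Automaton.HasZero.of_isomorphic h,
      SymbolicAutomata.Automaton.HasZero.of_isomorphic_symm h⟩, c.syntacticGraphsIsomorphic hM hN⟩
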